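/- For each $n$ let $V=\{1,\dots,n\}$, let $p_{ij}=p_{ji}\in[0,1]$ ($i\ne j$) be edge probabilities, let $r=r_n$ be a community size with $r\to\infty$, and for each $C\subseteq V$ with $|C|=r$ let $\beta_C\ge 1$ be a scaling factor with $\beta_C\,p_{ij}\le 1$ for all distinct $i,j\in C$; all of these may depend on $n$. Let $\mathbb P_0$ be the law of the random graph on $V$ whose edges $\{i,j\}$ are present independently with probability $p_{ij}$, and let $\mathbb P_C$ be the same law but with $p_{ij}$ replaced by $\beta_C p_{ij}$ for $i,j\in C$. A test is a function $\psi$ from graphs on $V$ to $\{0,1\}$, and its worst-case risk is $$R_n(\psi)=\mathbb P_0(\psi\neq 0)+\max_{C\subseteq V,\,|C|=r}\mathbb P_C(\psi\ne 1).$$ For $D\subseteq V$ let $e(D)$ be the number of edges with both endpoints in $D$, and let $\overline p_D=\mathbb E_0[e(D)]/\binom{|D|}{2}$ (with $\overline p_D=0$ if $|D|\le 1$). Put $h(x)=(x+1)\log(x+1)-x$. Assume that $$\max_{|C|=r}\ \max_{i,j\in C,\ i\ne j}\beta_C^2\,p_{ij}\to 0\qquad(n\to\infty)$$ and that at least one of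 the following two sets of conditions holds. (A) There is $\delta\in(0,1/2)$ such that (i) $r=O(n^{1/2-\delta})$; (ii) there are $\gamma_n>0$ with $\gamma_n\to0$ such that, for all large $n$, $\dfrac{|D|\,\overline p_D}{|C|\,\overline p_C}\le\delta$ for all $C\subseteq V$ with $|C|=r$ and all $D\subseteq C$ with $|D|<r/(n/r)^{\gamma_n}$; (iii) $\max_{|C|=r}1/\overline p_C=o\bigl(r/\log(n/r)\bigr)$. (B) (i) $r=n^{o(1)}$; (ii) $\max_{|C|=r}\log(1/\overline p_C)=o\bigl(\log(n/r)/\log r\bigr)$. (In (iii) and in (B)(ii), $1/0$ is read as $+\infty$.) Let $0<\epsilon<1$ be fixed and suppose that, for all large $n$ and all $C\subseteq V$ with $|C|=r$, $$\max_{\emptyset\ne D\subseteq C}\frac{\mathbb E_0[e(D)]\,h(\beta_C-1)}{|D|\log(n/|D|)}\le 1-\epsilon .$$ Then all tests are asymptotically powerless, in the minimax sense that $$\min_{\psi}R_n(\psi)\to 1\qquad(n\to\infty),$$ the minimum being over all tests. Consequently every sequence of tests $(\psi_n)$ satisfies $\liminf_n R_n(\psi_n)\ge 1$, and $R_n(\psi_n)\to1$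 for every sequence of tests with $\limsup_n R_n(\psi_n)\le 1$ (that is, asymptotically no worse than the trivial test $\psi\equiv 0$, whose risk is $1$). -/

import Mathlib

open Filter Topology Asymptotics
open scoped Classical

noncomputable section

namespace PlantedCommunity

/-- The unordered pairs of distinct vertices of `D`, each listed once as `(i, j)` with `i < j`. -/
def pairs {n : ℕ} (D : Finset (Fin n)) : Finset (Fin n × Fin n) :=
  (D ×ˢ D).filter fun e => e.1 < e.2

/-- The probability of the graph `G` when the edges `{i, j}`, `i ≠ j`, are present independently
with probabilities `q i j`. -/
def graphProb {n : ℕ} (q : Fin n → Fin n → ℝ) (G : SimpleGraph (Fin n)) : ℝ :=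
  ∏ e ∈ pairs (Finset.univ : Finset (Fin n)), if G.Adj e.1 e.2 then q e.1 e.2 else 1 - q e.1 e.2

/-- The probability of an event under the law of the inhomogeneous random graph with edge
probabilities `q`. -/
def prob {n : ℕ} (q : Fin n → Fin n → ℝ) (S : Set (SimpleGraph (Fin n))) : ℝ :=
  ∑ G : SimpleGraph (Fin n), if G ∈ S then graphProb q G else 0

/-- The expectation under the law of the inhomogeneous random graph with edge probabilities `q`. -/
def expect {n : ℕ} (q : Fin n → Fin n → ℝ) (f : SimpleGraph (Fin n) → ℝ) : ℝ :=
  ∑ G : SimpleGraph (Fin n), graphProb q G * f G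

/-- `e(D)`: the number of edges of `G` with both endpoints in `D`. -/
def edgeCount {n : ℕ} (D : Finset (Fin n)) (G : SimpleGraph (Fin n)) : ℕ :=
  ((pairs D).filter fun e => G.Adj e.1 e.2).card

/-- The entropy function `h(x) = (x + 1) log (x + 1) - x`. -/
def h (x : ℝ) : ℝ := (x + 1) * Real.log (x + 1) - x

/-- The parameters of the testing problem on `n` vertices: the size `r` of the planted community,
the edge probabilities `p i j` (the diagonal plays no role), and the scaling factors `β C ≥ 1` of
the possible communities `C`, such that the scaled numbers `β C * p i j` are probabilities. -/
structure Model (n : ℕ) where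
  r : ℕ
  p : Fin n → Fin n → ℝ
  β : Finset (Fin n) → ℝ
  p_symm : ∀ i j, p i j = p j i
  p_nonneg : ∀ i j, i ≠ j → 0 ≤ p i j
  p_le_one : ∀ i j, i ≠ j → p i j ≤ 1
  one_le_β : ∀ C : Finset (Fin n), C.card = r → 1 ≤ β C
  β_mul_p_le_one : ∀ C : Finset (Fin n), C.card = r →
    ∀ i ∈ C, ∀ j ∈ C, i ≠ j → β C * p i j ≤ 1

namespace Model

variable {n : ℕ} (M : Model n)

/-- The edge probabilities when `C` is the planted community. -/
def plantedP (C : Finset (Fin n)) (i j : Fin n) : ℝ :=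
  if i ∈ C ∧ j ∈ C then M.β C * M.p i j else M.p i j

/-- `E₀[e(D)]`: the expected number of edges inside `D` under the null hypothesis. -/
def expEdges (D : Finset (Fin n)) : ℝ := expect M.p fun G => (edgeCount D G : ℝ)

/-- The average edge probability of `D` (with value `0` when `D` has at most one element). -/
def avgP (D : Finset (Fin n)) : ℝ := M.expEdges D / (D.card.choose 2 : ℝ)

/-- The worst-case risk of a test `ψ`, where `ψ G = true` means that the null hypothesis is
rejected: the type-I error plus the largest type-II error over all communities of size `r`. -/
def risk (ψ : SimpleGraph (Fin n) → Bool) : ℝ :=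
  prob M.p {G | ψ G ≠ false} +
    ⨆ C : {C : Finset (Fin n) // C.card = M.r}, prob (M.plantedP C) {G | ψ G ≠ true}

/-- The minimax risk: the least worst-case risk over all tests. -/
def minimaxRisk : ℝ := ⨅ ψ : SimpleGraph (Fin n) → Bool, M.risk ψ

end Model

/-- Large communities: for some `δ ∈ (0, 1/2)`,
(i) `r = O(n^(1/2 - δ))`;
(ii) for some `0 < γ_n → 0`, the ratio `|D| p̄_D / (|C| p̄_C)` is at most `δ` for all `D ⊆ C` with
`|C| = r` and `|D| < r / (n / r)^γ_n`;
(iii) `max_C 1 / p̄_C = o(r / log (n / r))`, where `1 / p̄_C` is infinite if `p̄_C = 0`. -/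
def LargeCommunity (M : ∀ n, Model n) : Prop :=
  ∃ δ : ℝ, 0 < δ ∧ δ < 1 / 2 ∧
    ((fun n => ((M n).r : ℝ)) =O[atTop] fun n : ℕ => (n : ℝ) ^ (1 / 2 - δ)) ∧
    (∃ γ : ℕ → ℝ, (∀ n, 0 < γ n) ∧ Tendsto γ atTop (𝓝 0) ∧
      ∀ᶠ n : ℕ in atTop, ∀ C : Finset (Fin n), C.card = (M n).r → ∀ D ⊆ C,
        (D.card : ℝ) < ((M n).r : ℝ) / ((n : ℝ) / ((M n).r : ℝ)) ^ γ n →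
          (D.card : ℝ) * (M n).avgP D / ((C.card : ℝ) * (M n).avgP C) ≤ δ) ∧
    (∀ η : ℝ, 0 < η → ∀ᶠ n : ℕ in atTop, ∀ C : Finset (Fin n), C.card = (M n).r →
      0 < (M n).avgP C ∧
        1 / (M n).avgP C ≤ η * (((M n).r : ℝ) / Real.log ((n : ℝ) / ((M n).r : ℝ))))

/-- Small communities:
(i) `r = n^(o(1))`;
(ii) `max_C log (1 / p̄_C) = o(log (n / r) / log r)`, where `log (1 / p̄_C)` is infinite if
`p̄_C = 0`. -/
def SmallCommunity (M : ∀ n, Model n) : Prop :=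
  (∃ a : ℕ → ℝ, Tendsto a atTop (𝓝 0) ∧ ∀ᶠ n : ℕ in atTop, ((M n).r : ℝ) = (n : ℝ) ^ a n) ∧
    (∀ η : ℝ, 0 < η → ∀ᶠ n : ℕ in atTop, ∀ C : Finset (Fin n), C.card = (M n).r →
      0 < (M n).avgP C ∧
        Real.log (1 / (M n).avgP C) ≤
          η * (Real.log ((n : ℝ) / ((M n).r : ℝ)) / Real.log ((M n).r : ℝ)))

/-- Sparsity: the maximum of `β_C² p_ij` over all `C` of size `r` and distinct `i, j ∈ C` tends
to `0`. -/
def Sparse (M : ∀ n, Model n) : Prop :=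
  ∀ η : ℝ, 0 < η → ∀ᶠ n : ℕ in atTop, ∀ C : Finset (Fin n), C.card = (M n).r →
    ∀ i ∈ C, ∀ j ∈ C, i ≠ j → (M n).β C ^ 2 * (M n).p i j ≤ η

/-- The signal is too weak: for all large `n`, all `C` of size `r` and all nonempty `D ⊆ C`,
`E₀[e(D)] h(β_C - 1) / (|D| log (n / |D|)) ≤ 1 - ε`. -/
def WeakSignal (M : ∀ n, Model n) (ε : ℝ) : Prop :=
  ∀ᶠ n : ℕ in atTop, ∀ C : Finset (Fin n), C.card = (M n).r → ∀ D ⊆ C, D.Nonempty →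
    (M n).expEdges D * h ((M n).β C - 1) /
      ((D.card : ℝ) * Real.log ((n : ℝ) / (D.card : ℝ))) ≤ 1 - ε

end PlantedCommunity

end

/-! The test that never rejects has risk at most 1, so everything rests on a lower bound for the
risk of an arbitrary test, obtained by a truncated second moment argument. The largest type-II error
is at least its average over uniform `r`-sets `C`. Let `L_C` be the likelihood ratio of `C`, let
`Γ_C` be the event that no `D ⊆ C` (of the sizes to be truncated) has too many edges, and let `L̃`
be the average of `L_C 1_{Γ_C}`. Cauchy–Schwarz bounds the risk below by `1 - √E₀[(L̃ - 1)²]`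
(`Model.one_sub_sqrt_le_risk`).

In `E₀[L̃²]`, a pair `C₁, C₂` only matters through `D = C₁ ∩ C₂`: the likelihood factors outside the
overlap integrate to 1. Overlaps of size `k` have weight at most `(r choose k) (r/n)^k`, so if their
contribution is at most `exp (k A_k)` the sum is geometric as soon as `1 + log (r/k) + A_k + κ ≤ log
(n/r)`.

Without truncation the exponent on `D` is about `(β - 1)² E₀[e(D)]`, which can be too large. On
`Γ_C` it drops to about `h(β - 1) E₀[e(D)]`, which the weak signal assumption bounds by `(1 - ε) k
log (n/k)`. A union bound with Bernstein's inequality makes `Γ_C` likely under the planted law once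
the level `λ` per vertex exceeds `log (r/k) + 1 + κ`; the price is an error term in `λ log β` that
must be small compared with `ℓ = log (n/r)` (`truncated_exponent_le`).

For small communities `λ = 2 log r` works for every `k`, since `log β ≤ log (1/p̄_C) / 2`. For large
communities `β` is close to 1. Sizes `k ≥ r/(n/r)^γ` are truncated with `λ` close to `γ ℓ`; smaller
sizes need no truncation, because `(β - 1)²` is then about `2 h(β - 1)` and the density ratio `δ <
1/2` absorbs the factor 2. Taking `κ` arbitrarily large finishes the proof. -/

noncomputable section

namespace PlantedCommunity

/-! ### Products over pairs and their expectations under independent edges -/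

section EdgeProducts

variable {n : ℕ}

/-- The product over the pairs in `S` of `a e` for the edges and `b e` for the non-edges of `G`. -/
def edgeProd (S : Finset (Fin n × Fin n)) (a b : Fin n × Fin n → ℝ)
    (G : SimpleGraph (Fin n)) : ℝ :=
  ∏ e ∈ S, if G.Adj e.1 e.2 then a e else b e

theorem mem_pairs {D : Finset (Fin n)} {e : Fin n × Fin n} :
    e ∈ pairs D ↔ e.1 ∈ D ∧ e.2 ∈ D ∧ e.1 < e.2 := by
  simp [pairs, and_assoc]

theorem pairs_mono {D C : Finset (Fin n)} (hD : D ⊆ C) : pairs D ⊆ pairs C := by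
  intro e he
  rw [mem_pairs] at he ⊢
  exact ⟨hD he.1, hD he.2.1, he.2.2⟩

theorem pairs_subset_univ (D : Finset (Fin n)) : pairs D ⊆ pairs Finset.univ :=
  pairs_mono (Finset.subset_univ D)

theorem pairs_inter (C D : Finset (Fin n)) : pairs (C ∩ D) = pairs C ∩ pairs D := by
  ext e
  simp only [mem_pairs, Finset.mem_inter]
  tauto

theorem pairs_empty : pairs (∅ : Finset (Fin n)) = ∅ := by simp [pairs]

theorem card_pairs (D : Finset (Fin n)) : (pairs D).card = D.card.choose 2 := by
  rw [← Finset.card_powersetCard 2 D]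
  refine Finset.card_bij (fun e _ => {e.1, e.2}) ?_ ?_ ?_
  · intro e he
    rw [mem_pairs] at he
    rw [Finset.mem_powersetCard]
    refine ⟨?_, Finset.card_pair he.2.2.ne⟩
    intro i hi
    simp only [Finset.mem_insert, Finset.mem_singleton] at hi
    rcases hi with rfl | rfl
    exacts [he.1, he.2.1]
  · rintro ⟨a, b⟩ hab ⟨c, d⟩ hcd heq
    rw [mem_pairs] at hab hcd
    have h1 := hab.2.2
    have h2 := hcd.2.2
    simp only at h1 h2 heq
    have ha : a ∈ ({c, d} : Finset (Fin n)) := heq ▸ (by simp)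
    have hb : b ∈ ({c, d} : Finset (Fin n)) := heq ▸ (by simp)
    simp only [Finset.mem_insert, Finset.mem_singleton] at ha hb
    rcases ha with rfl | rfl <;> rcases hb with rfl | rfl
    · exact absurd h1 (lt_irrefl _)
    · rfl
    · exact absurd h1 (not_lt.2 h2.le)
    · exact absurd h1 (lt_irrefl _)
  · intro s hs
    rw [Finset.mem_powersetCard, Finset.card_eq_two] at hs
    obtain ⟨hs, a, b, hab, rfl⟩ := hs
    have ha : a ∈ D := hs (by simp)
    have hb : b ∈ D := hs (by simp)
    rcases lt_or_gt_of_ne hab with hlt | hlt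
    · exact ⟨(a, b), mem_pairs.2 ⟨ha, hb, hlt⟩, rfl⟩
    · exact ⟨(b, a), mem_pairs.2 ⟨hb, ha, hlt⟩, Finset.pair_comm _ _⟩

/-- Graphs correspond to sets of pairs `i < j`, so the sum is the expansion of the product on the
right. -/
theorem sum_edgeProd (a b : Fin n × Fin n → ℝ) :
    ∑ G : SimpleGraph (Fin n), edgeProd (pairs Finset.univ) a b G =
      ∏ e ∈ pairs Finset.univ, (a e + b e) := by
  rw [Finset.prod_add]
  refine Finset.sum_nbij' (fun G => (pairs Finset.univ).filter fun e => G.Adj e.1 e.2)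
    (fun t => SimpleGraph.fromRel fun i j => (i, j) ∈ t) ?_ ?_ ?_ ?_ ?_
  · intro G _
    exact Finset.mem_powerset.2 (Finset.filter_subset _ _)
  · intro t _
    exact Finset.mem_univ _
  · intro G _
    ext i j
    simp only [SimpleGraph.fromRel_adj, Finset.mem_filter, mem_pairs, Finset.mem_univ, true_and]
    constructor
    · rintro ⟨_, h | h⟩
      exacts [h.2, h.2.symm]
    · intro h
      refine ⟨h.ne, ?_⟩
      rcases lt_or_gt_of_ne h.ne with hlt | hlt
      exacts [Or.inl ⟨hlt, h⟩, Or.inr ⟨hlt, h.symm⟩]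
  · intro t ht
    rw [Finset.mem_powerset] at ht
    ext ⟨i, j⟩
    simp only [SimpleGraph.fromRel_adj, Finset.mem_filter]
    constructor
    · rintro ⟨hij, _, h | h⟩
      · exact h
      · have h1 := (mem_pairs.1 (ht h)).2.2
        have h2 := (mem_pairs.1 hij).2.2
        exact absurd h1 (not_lt.2 h2.le)
    · intro h
      have h1 := (mem_pairs.1 (ht h)).2.2
      exact ⟨ht h, h1.ne, Or.inl h⟩
  · intro G _
    unfold edgeProd
    rw [Finset.prod_ite, Finset.filter_not]

theorem edgeProd_mul_of_disjoint {S T : Finset (Fin n × Fin n)} (hST : Disjoint S T)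
    (a b a' b' : Fin n × Fin n → ℝ) (G : SimpleGraph (Fin n)) :
    edgeProd S a b G * edgeProd T a' b' G =
      edgeProd (S ∪ T) (fun e => if e ∈ S then a e else a' e)
        (fun e => if e ∈ S then b e else b' e) G := by
  unfold edgeProd
  rw [Finset.prod_union hST]
  congr 1
  · refine Finset.prod_congr rfl fun e he => ?_
    simp [he]
  · refine Finset.prod_congr rfl fun e he => ?_
    simp [Finset.disjoint_right.1 hST he]

theorem edgeProd_mul (S : Finset (Fin n × Fin n)) (a b a' b' : Fin n × Fin n → ℝ)
    (G : SimpleGraph (Fin n)) :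
    edgeProd S a b G * edgeProd S a' b' G =
      edgeProd S (fun e => a e * a' e) (fun e => b e * b' e) G := by
  unfold edgeProd
  rw [← Finset.prod_mul_distrib]
  refine Finset.prod_congr rfl fun e _ => ?_
  split_ifs <;> rfl

theorem edgeProd_nonneg {S : Finset (Fin n × Fin n)} {a b : Fin n × Fin n → ℝ}
    (ha : ∀ e ∈ S, 0 ≤ a e) (hb : ∀ e ∈ S, 0 ≤ b e) (G : SimpleGraph (Fin n)) :
    0 ≤ edgeProd S a b G := by
  refine Finset.prod_nonneg fun e he => ?_
  split_ifs
  exacts [ha e he, hb e he]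

theorem edgeProd_const_one (c : ℝ) (D : Finset (Fin n)) (G : SimpleGraph (Fin n)) :
    edgeProd (pairs D) (fun _ => c) (fun _ => 1) G = c ^ edgeCount D G := by
  unfold edgeProd edgeCount
  rw [Finset.prod_ite]
  simp

theorem expect_edgeProd (q : Fin n → Fin n → ℝ) {S : Finset (Fin n × Fin n)}
    (hS : S ⊆ pairs Finset.univ) (a b : Fin n × Fin n → ℝ) :
    expect q (edgeProd S a b) =
      ∏ e ∈ S, (q e.1 e.2 * a e + (1 - q e.1 e.2) * b e) := by
  have key : ∀ G : SimpleGraph (Fin n), graphProb q G * edgeProd S a b G =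
      edgeProd (pairs Finset.univ)
        (fun e => if e ∈ S then q e.1 e.2 * a e else q e.1 e.2)
        (fun e => if e ∈ S then (1 - q e.1 e.2) * b e else 1 - q e.1 e.2) G := by
    intro G
    unfold graphProb edgeProd
    rw [← Finset.prod_sdiff hS, ← Finset.prod_sdiff hS, mul_assoc, ← Finset.prod_mul_distrib]
    congr 1
    · refine Finset.prod_congr rfl fun e he => ?_
      simp [(Finset.mem_sdiff.1 he).2]
    · refine Finset.prod_congr rfl fun e he => ?_
      simp only [he, if_true]
      split_ifs <;> rfl
  unfold expect
  rw [Finset.sum_congr rfl fun G _ => key G, sum_edgeProd, ← Finset.prod_sdiff hS]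
  rw [Finset.prod_eq_one, one_mul]
  · refine Finset.prod_congr rfl fun e he => ?_
    simp [he]
  · intro e he
    simp [(Finset.mem_sdiff.1 he).2]

theorem expect_edgeProd_mul (q : Fin n → Fin n → ℝ) {S T : Finset (Fin n × Fin n)}
    (hS : S ⊆ pairs Finset.univ) (hT : T ⊆ pairs Finset.univ) (hST : Disjoint S T)
    (a b a' b' : Fin n × Fin n → ℝ) :
    expect q (fun G => edgeProd S a b G * edgeProd T a' b' G) =
      (∏ e ∈ S, (q e.1 e.2 * a e + (1 - q e.1 e.2) * b e)) *
        ∏ e ∈ T, (q e.1 e.2 * a' e + (1 - q e.1 e.2) * b' e) := by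
  have hfun : (fun G => edgeProd S a b G * edgeProd T a' b' G) =
      edgeProd (S ∪ T) (fun e => if e ∈ S then a e else a' e)
        (fun e => if e ∈ S then b e else b' e) :=
    funext fun G => edgeProd_mul_of_disjoint hST a b a' b' G
  rw [hfun, expect_edgeProd q (Finset.union_subset hS hT), Finset.prod_union hST]
  congr 1
  · refine Finset.prod_congr rfl fun e he => ?_
    simp [he]
  · refine Finset.prod_congr rfl fun e he => ?_
    simp [Finset.disjoint_right.1 hST he]

theorem expect_edgeProd_mul_mul (q : Fin n → Fin n → ℝ) {S T U : Finset (Fin n × Fin n)}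
    (hS : S ⊆ pairs Finset.univ) (hT : T ⊆ pairs Finset.univ) (hU : U ⊆ pairs Finset.univ)
    (hST : Disjoint S T) (hSU : Disjoint S U) (hTU : Disjoint T U)
    (a b a' b' a'' b'' : Fin n × Fin n → ℝ) :
    expect q (fun G => edgeProd S a b G * (edgeProd T a' b' G * edgeProd U a'' b'' G)) =
      (∏ e ∈ S, (q e.1 e.2 * a e + (1 - q e.1 e.2) * b e)) *
        ((∏ e ∈ T, (q e.1 e.2 * a' e + (1 - q e.1 e.2) * b' e)) *
          ∏ e ∈ U, (q e.1 e.2 * a'' e + (1 - q e.1 e.2) * b'' e)) := by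
  simp only [edgeProd_mul_of_disjoint hTU]
  rw [expect_edgeProd_mul q hS (Finset.union_subset hT hU)
    (Finset.disjoint_union_right.2 ⟨hST, hSU⟩), Finset.prod_union hTU]
  congr 2
  · refine Finset.prod_congr rfl fun e he => ?_
    simp [he]
  · refine Finset.prod_congr rfl fun e he => ?_
    simp [Finset.disjoint_right.1 hTU he]

end EdgeProducts

/-! ### Elementary properties of expectation and probability -/

section Expectation

variable {n : ℕ} {q : Fin n → Fin n → ℝ}

theorem graphProb_nonneg (h0 : ∀ i j, i ≠ j → 0 ≤ q i j) (h1 : ∀ i j, i ≠ j → q i j ≤ 1)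
    (G : SimpleGraph (Fin n)) : 0 ≤ graphProb q G := by
  refine Finset.prod_nonneg fun e he => ?_
  have hne := (mem_pairs.1 he).2.2.ne
  split_ifs
  exacts [h0 _ _ hne, sub_nonneg.2 (h1 _ _ hne)]

theorem sum_graphProb (q : Fin n → Fin n → ℝ) : ∑ G : SimpleGraph (Fin n), graphProb q G = 1 := by
  have := sum_edgeProd (n := n) (fun e => q e.1 e.2) (fun e => 1 - q e.1 e.2)
  unfold edgeProd at this
  unfold graphProb
  rw [this]
  exact Finset.prod_eq_one fun e _ => by ring

theorem expect_const (q : Fin n → Fin n → ℝ) (c : ℝ) : expect q (fun _ => c) = c := by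
  unfold expect
  rw [← Finset.sum_mul, sum_graphProb, one_mul]

theorem expect_mono (h0 : ∀ i j, i ≠ j → 0 ≤ q i j) (h1 : ∀ i j, i ≠ j → q i j ≤ 1)
    {f g : SimpleGraph (Fin n) → ℝ} (hfg : ∀ G, f G ≤ g G) : expect q f ≤ expect q g :=
  Finset.sum_le_sum fun G _ => mul_le_mul_of_nonneg_left (hfg G) (graphProb_nonneg h0 h1 G)

theorem expect_add (f g : SimpleGraph (Fin n) → ℝ) :
    expect q (fun G => f G + g G) = expect q f + expect q g := by
  simp only [expect, mul_add, Finset.sum_add_distrib]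

theorem expect_sub (f g : SimpleGraph (Fin n) → ℝ) :
    expect q (fun G => f G - g G) = expect q f - expect q g := by
  simp only [expect, mul_sub, Finset.sum_sub_distrib]

theorem expect_const_mul (c : ℝ) (f : SimpleGraph (Fin n) → ℝ) :
    expect q (fun G => c * f G) = c * expect q f := by
  simp only [expect, Finset.mul_sum]
  exact Finset.sum_congr rfl fun G _ => by ring

theorem expect_sum {ι : Type*} (s : Finset ι) (f : ι → SimpleGraph (Fin n) → ℝ) :
    expect q (fun G => ∑ i ∈ s, f i G) = ∑ i ∈ s, expect q (f i) := by
  simp only [expect, Finset.mul_sum]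
  exact Finset.sum_comm

theorem prob_eq_expect (q : Fin n → Fin n → ℝ) (S : Set (SimpleGraph (Fin n))) :
    prob q S = expect q (S.indicator 1) := by
  unfold prob expect
  refine Finset.sum_congr rfl fun G _ => ?_
  by_cases hG : G ∈ S <;> simp [hG]

theorem prob_le_one (h0 : ∀ i j, i ≠ j → 0 ≤ q i j) (h1 : ∀ i j, i ≠ j → q i j ≤ 1)
    (S : Set (SimpleGraph (Fin n))) : prob q S ≤ 1 := by
  rw [← sum_graphProb q]
  refine Finset.sum_le_sum fun G _ => ?_
  split_ifs
  exacts [le_rfl, graphProb_nonneg h0 h1 G]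

theorem sq_expect_le (h0 : ∀ i j, i ≠ j → 0 ≤ q i j) (h1 : ∀ i j, i ≠ j → q i j ≤ 1)
    (f : SimpleGraph (Fin n) → ℝ) : expect q f ^ 2 ≤ expect q (fun G => f G ^ 2) := by
  have hpos := expect_mono h0 h1 (f := fun _ => 0) (g := fun G => (f G - expect q f) ^ 2)
    fun G => sq_nonneg _
  have hexp : expect q (fun G => (f G - expect q f) ^ 2) =
      expect q (fun G => f G ^ 2) - expect q f ^ 2 := by
    have : (fun G => (f G - expect q f) ^ 2) =
        fun G => (f G ^ 2 - (2 * expect q f) * f G) + expect q f ^ 2 := by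
      funext G; ring
    rw [this, expect_add, expect_sub, expect_const_mul, expect_const]
    ring
  rw [hexp, expect_const] at hpos
  linarith

theorem expect_edgeCount (q : Fin n → Fin n → ℝ) (D : Finset (Fin n)) :
    expect q (fun G => (edgeCount D G : ℝ)) = ∑ e ∈ pairs D, q e.1 e.2 := by
  have hcount : (fun G : SimpleGraph (Fin n) => (edgeCount D G : ℝ)) =
      fun G => ∑ e ∈ pairs D, edgeProd {e} (fun _ => 1) (fun _ => 0) G := by
    funext G
    simp [edgeCount, edgeProd]
  rw [hcount, expect_sum]
  refine Finset.sum_congr rfl fun e he => ?_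
  have hsub : ({e} : Finset (Fin n × Fin n)) ⊆ pairs Finset.univ := by
    rw [Finset.singleton_subset_iff]
    exact pairs_subset_univ D he
  rw [expect_edgeProd q hsub]
  simp

end Expectation

/-! ### Likelihood ratios and change of measure -/

namespace Model

variable {n : ℕ} (M : Model n)

/-- The likelihood ratio, restricted to the pairs in `S`, of the community `C` against the null
hypothesis. -/
def likelihood (C : Finset (Fin n)) (S : Finset (Fin n × Fin n)) : SimpleGraph (Fin n) → ℝ :=
  edgeProd S (fun _ => M.β C) (fun e => (1 - M.β C * M.p e.1 e.2) / (1 - M.p e.1 e.2))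

theorem expEdges_eq_sum (D : Finset (Fin n)) : M.expEdges D = ∑ e ∈ pairs D, M.p e.1 e.2 :=
  expect_edgeCount M.p D

theorem expEdges_nonneg (D : Finset (Fin n)) : 0 ≤ M.expEdges D := by
  rw [expEdges_eq_sum]
  exact Finset.sum_nonneg fun e he => M.p_nonneg _ _ (mem_pairs.1 he).2.2.ne

variable {M} {C : Finset (Fin n)}

theorem plantedP_nonneg (hC : C.card = M.r) (i j : Fin n) (hij : i ≠ j) :
    0 ≤ M.plantedP C i j := by
  unfold plantedP
  have h1 := M.p_nonneg i j hij
  have h2 := M.one_le_β C hC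
  split_ifs
  · positivity
  · exact h1

theorem plantedP_le_one (hC : C.card = M.r) (i j : Fin n) (hij : i ≠ j) :
    M.plantedP C i j ≤ 1 := by
  unfold plantedP
  split_ifs with h
  · exact M.β_mul_p_le_one C hC i h.1 j h.2 hij
  · exact M.p_le_one i j hij

theorem plantedP_of_mem_pairs {e : Fin n × Fin n} (he : e ∈ pairs C) :
    M.plantedP C e.1 e.2 = M.β C * M.p e.1 e.2 := by
  have := mem_pairs.1 he
  simp [plantedP, this.1, this.2.1]

theorem graphProb_plantedP (hp : ∀ e ∈ pairs C, M.p e.1 e.2 < 1) (G : SimpleGraph (Fin n)) :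
    graphProb (M.plantedP C) G = graphProb M.p G * M.likelihood C (pairs C) G := by
  unfold graphProb likelihood edgeProd
  rw [← Finset.prod_sdiff (pairs_subset_univ C), ← Finset.prod_sdiff (pairs_subset_univ C),
    mul_assoc, ← Finset.prod_mul_distrib]
  congr 1
  · refine Finset.prod_congr rfl fun e he => ?_
    have h2 := Finset.mem_sdiff.1 he
    have h3 : ¬ (e.1 ∈ C ∧ e.2 ∈ C) := fun h =>
      h2.2 (mem_pairs.2 ⟨h.1, h.2, (mem_pairs.1 h2.1).2.2⟩)
    simp [plantedP, h3]
  · refine Finset.prod_congr rfl fun e he => ?_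
    have h2 := mem_pairs.1 he
    have h3 : 1 - M.p e.1 e.2 ≠ 0 := (sub_pos.2 (hp e he)).ne'
    simp only [plantedP, h2.1, h2.2.1, and_self, if_true]
    split_ifs
    · ring
    · field_simp

theorem expect_plantedP (hp : ∀ e ∈ pairs C, M.p e.1 e.2 < 1) (f : SimpleGraph (Fin n) → ℝ) :
    expect (M.plantedP C) f = expect M.p fun G => M.likelihood C (pairs C) G * f G := by
  unfold expect
  refine Finset.sum_congr rfl fun G _ => ?_
  rw [graphProb_plantedP hp, mul_assoc]

theorem likelihood_nonneg (hC : C.card = M.r) {S : Finset (Fin n × Fin n)} (hS : S ⊆ pairs C)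
    (G : SimpleGraph (Fin n)) : 0 ≤ M.likelihood C S G := by
  have hβ := M.one_le_β C hC
  refine edgeProd_nonneg (fun _ _ => by positivity) (fun e he => ?_) G
  have h2 := mem_pairs.1 (hS he)
  exact div_nonneg
    (sub_nonneg.2 (M.β_mul_p_le_one C hC _ h2.1 _ h2.2.1 h2.2.2.ne))
    (sub_nonneg.2 (M.p_le_one _ _ h2.2.2.ne))

end Model

/-! ### Overlaps of random `r`-sets -/

section Overlap

/-- This says that a uniform `r`-set contains a given `k`-set with probability at most `(r/n)^k`;
each step of the induction multiplies by `(r - k)/(n - k) ≤ r/n`. -/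
theorem choose_sub_mul_pow_le {n r : ℕ} (hrn : r ≤ n) :
    ∀ k ≤ r, (n - k).choose (r - k) * n ^ k ≤ n.choose r * r ^ k := by
  intro k
  induction k with
  | zero => simp
  | succ k ih =>
    intro hk
    have ih' := ih (by omega)
    obtain ⟨b, hb⟩ : ∃ b, r = k + 1 + b := ⟨r - (k + 1), by omega⟩
    obtain ⟨c, hc⟩ : ∃ c, n = r + c := ⟨n - r, by omega⟩
    have e1 : n - (k + 1) = b + c := by omega
    have e2 : r - (k + 1) = b := by omega
    have e3 : n - k = b + c + 1 := by omega
    have e4 : r - k = b + 1 := by omega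
    rw [e3, e4] at ih'
    rw [e1, e2]
    have hs := Nat.add_one_mul_choose_eq (b + c) b
    have hle : (b + 1) * n ≤ (b + c + 1) * r := by
      rw [hc, hb]; nlinarith [Nat.zero_le (c * k)]
    refine Nat.le_of_mul_le_mul_left ?_ (Nat.succ_pos (b + c))
    calc (b + c + 1) * ((b + c).choose b * n ^ (k + 1))
        = ((b + c + 1) * (b + c).choose b) * n ^ k * n := by ring
      _ = ((b + c + 1).choose (b + 1) * n ^ k) * ((b + 1) * n) := by rw [hs]; ring
      _ ≤ (n.choose r * r ^ k) * ((b + c + 1) * r) := Nat.mul_le_mul ih' hle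
      _ = (b + c + 1) * (n.choose r * r ^ (k + 1)) := by ring

variable {n : ℕ}

theorem card_supersets_le (r : ℕ) (S : Finset (Fin n)) :
    ((Finset.powersetCard r Finset.univ).filter fun C => S ⊆ C).card ≤
      (n - S.card).choose (r - S.card) := by
  have hcard : (Finset.powersetCard (r - S.card) (Finset.univ \ S)).card =
      (n - S.card).choose (r - S.card) := by
    rw [Finset.card_powersetCard, Finset.card_sdiff_of_subset (Finset.subset_univ S)]
    simp
  rw [← hcard]
  refine Finset.card_le_card_of_injOn (fun C => C \ S) ?_ ?_
  · intro C hC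
    simp only [Finset.coe_filter, Finset.mem_powersetCard, Set.mem_ofPred_eq] at hC
    simp only [Finset.mem_coe, Finset.mem_powersetCard]
    exact ⟨Finset.sdiff_subset_sdiff (Finset.subset_univ _) le_rfl,
      by rw [Finset.card_sdiff_of_subset hC.2, hC.1.2]⟩
  · intro C hC C' hC' heq
    simp only [Finset.coe_filter, Finset.mem_powersetCard, Set.mem_ofPred_eq] at hC hC'
    simp only at heq
    rw [← Finset.sdiff_union_of_subset hC.2, heq, Finset.sdiff_union_of_subset hC'.2]

theorem card_supersets_le_mul_pow {r : ℕ} (hn : 0 < n) (hrn : r ≤ n) {S : Finset (Fin n)}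
    (hS : S.card ≤ r) :
    (((Finset.powersetCard r Finset.univ).filter fun C => S ⊆ C).card : ℝ) ≤
      n.choose r * ((r : ℝ) / n) ^ S.card := by
  have h1 : (((Finset.powersetCard r Finset.univ).filter fun C => S ⊆ C).card : ℝ) ≤
      ((n - S.card).choose (r - S.card) : ℕ) := by
    exact_mod_cast card_supersets_le r S
  have h2 : (((n - S.card).choose (r - S.card) : ℕ) : ℝ) * (n : ℝ) ^ S.card ≤
      (n.choose r : ℝ) * (r : ℝ) ^ S.card := by
    exact_mod_cast choose_sub_mul_pow_le hrn S.card hS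
  have hn' : (0 : ℝ) < (n : ℝ) ^ S.card := by positivity
  refine h1.trans ?_
  rw [div_pow, ← mul_div_assoc, le_div_iff₀ hn']
  exact h2

/-- The sum of a function of the size of the overlap of a fixed `r`-set with a running one. -/
theorem sum_overlap_le {r : ℕ} (hn : 0 < n) (hrn : r ≤ n) {w : ℕ → ℝ} (hw : ∀ k, 0 ≤ w k)
    {C : Finset (Fin n)} (hC : C.card = r) :
    ∑ C' ∈ Finset.powersetCard r Finset.univ, w (C ∩ C').card ≤
      n.choose r *
        (w 0 + ∑ k ∈ Finset.Icc 1 r, (r.choose k : ℝ) * ((r : ℝ) / n) ^ k * w k) := by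
  -- Union bound: the overlap itself is one of the sets `S ⊆ C` contained in `C'`.
  have step : ∀ C' ∈ Finset.powersetCard r (Finset.univ : Finset (Fin n)), w (C ∩ C').card ≤
      w 0 + ∑ k ∈ Finset.Icc 1 r, ∑ S ∈ Finset.powersetCard k C,
        if S ⊆ C' then w k else 0 := by
    intro C' _
    have hnn : ∀ k, 0 ≤ ∑ S ∈ Finset.powersetCard k C, if S ⊆ C' then w k else 0 := by
      intro k
      refine Finset.sum_nonneg fun S _ => ?_
      split_ifs
      exacts [hw k, le_rfl]
    rcases Nat.eq_zero_or_pos (C ∩ C').card with h0 | hpos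
    · rw [h0]
      exact le_add_of_nonneg_right (Finset.sum_nonneg fun k _ => hnn k)
    · have hmem : (C ∩ C').card ∈ Finset.Icc 1 r :=
        Finset.mem_Icc.2 ⟨hpos, hC ▸ Finset.card_le_card Finset.inter_subset_left⟩
      have hS : C ∩ C' ∈ Finset.powersetCard (C ∩ C').card C :=
        Finset.mem_powersetCard.2 ⟨Finset.inter_subset_left, rfl⟩
      calc w (C ∩ C').card = if C ∩ C' ⊆ C' then w (C ∩ C').card else 0 := by
            rw [if_pos Finset.inter_subset_right]
        _ ≤ ∑ S ∈ Finset.powersetCard (C ∩ C').card C, if S ⊆ C' then w (C ∩ C').card else 0 := by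
            refine Finset.single_le_sum
              (f := fun S => if S ⊆ C' then w (C ∩ C').card else 0) (fun S _ => ?_) hS
            split_ifs
            exacts [hw _, le_rfl]
        _ ≤ ∑ k ∈ Finset.Icc 1 r, ∑ S ∈ Finset.powersetCard k C, if S ⊆ C' then w k else 0 :=
            Finset.single_le_sum
              (f := fun k => ∑ S ∈ Finset.powersetCard k C, if S ⊆ C' then w k else 0)
              (fun k _ => hnn k) hmem
        _ ≤ _ := le_add_of_nonneg_left (hw 0)
  refine (Finset.sum_le_sum step).trans ?_
  rw [Finset.sum_add_distrib, Finset.sum_const, Finset.card_powersetCard, Finset.card_univ,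
    Fintype.card_fin, nsmul_eq_mul, mul_add]
  refine add_le_add le_rfl ?_
  rw [Finset.sum_comm, Finset.mul_sum]
  refine Finset.sum_le_sum fun k hk => ?_
  rw [Finset.sum_comm]
  have hkr := (Finset.mem_Icc.1 hk).2
  have inner : ∀ S ∈ Finset.powersetCard k C,
      (∑ C' ∈ Finset.powersetCard r Finset.univ, if S ⊆ C' then w k else 0) ≤
        n.choose r * ((r : ℝ) / n) ^ k * w k := by
    intro S hS
    have hSk := (Finset.mem_powersetCard.1 hS).2
    rw [← Finset.sum_filter, Finset.sum_const, nsmul_eq_mul]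
    refine mul_le_mul_of_nonneg_right ?_ (hw k)
    have := card_supersets_le_mul_pow hn hrn (S := S) (hSk.trans_le hkr)
    rwa [hSk] at this
  refine (Finset.sum_le_sum inner).trans (le_of_eq ?_)
  rw [Finset.sum_const, Finset.card_powersetCard, hC, nsmul_eq_mul]
  ring

end Overlap

/-! ### The truncated second moment method -/

namespace Model

variable {n : ℕ} {M : Model n}

theorem likelihood_eq_mul {C : Finset (Fin n)} {S T : Finset (Fin n × Fin n)} (hST : S ⊆ T)
    (G : SimpleGraph (Fin n)) :
    M.likelihood C T G = M.likelihood C S G * M.likelihood C (T \ S) G := by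
  unfold likelihood edgeProd
  rw [mul_comm, Finset.prod_sdiff hST]

theorem prod_likelihood_eq_one {C : Finset (Fin n)} {S : Finset (Fin n × Fin n)}
    (hp : ∀ e ∈ S, M.p e.1 e.2 < 1) :
    ∏ e ∈ S, (M.p e.1 e.2 * M.β C +
      (1 - M.p e.1 e.2) * ((1 - M.β C * M.p e.1 e.2) / (1 - M.p e.1 e.2))) = 1 := by
  refine Finset.prod_eq_one fun e he => ?_
  rw [mul_div_cancel₀ _ (sub_pos.2 (hp e he)).ne']
  ring

/-- On the event `Γ`, the square of the likelihood ratio restricted to `D` is dominated by a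
product over the pairs in `D` with expectation at most `w`. -/
def SqBound (M : Model n) (C D : Finset (Fin n)) (Γ : Set (SimpleGraph (Fin n))) (w : ℝ) : Prop :=
  ∃ (κ : ℝ) (a b : Fin n × Fin n → ℝ),
    (∀ G, 0 ≤ κ * edgeProd (pairs D) a b G) ∧
    (∀ G ∈ Γ, M.likelihood C (pairs D) G ^ 2 ≤ κ * edgeProd (pairs D) a b G) ∧
    κ * ∏ e ∈ pairs D, (M.p e.1 e.2 * a e + (1 - M.p e.1 e.2) * b e) ≤ w

/-- The pairs inside the overlap, inside `C₁` only and inside `C₂` only are disjoint, hence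
independent. The truncation events need not factor, so they are first replaced by product bounds on
the overlap; the expectation then splits. -/
theorem expect_mul_likelihood_le {C₁ C₂ : Finset (Fin n)} {Γ₁ Γ₂ : Set (SimpleGraph (Fin n))}
    {w : ℝ} (h₁ : C₁.card = M.r) (h₂ : C₂.card = M.r)
    (hp₁ : ∀ e ∈ pairs C₁, M.p e.1 e.2 < 1) (hp₂ : ∀ e ∈ pairs C₂, M.p e.1 e.2 < 1)
    (hw₁ : M.SqBound C₁ (C₁ ∩ C₂) Γ₁ w) (hw₂ : M.SqBound C₂ (C₁ ∩ C₂) Γ₂ w) :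
    expect M.p (fun G => Γ₁.indicator (M.likelihood C₁ (pairs C₁)) G *
      Γ₂.indicator (M.likelihood C₂ (pairs C₂)) G) ≤ w := by
  obtain ⟨κ₁, a₁, b₁, hn₁, hd₁, hb₁⟩ := hw₁
  obtain ⟨κ₂, a₂, b₂, hn₂, hd₂, hb₂⟩ := hw₂
  set S := pairs (C₁ ∩ C₂) with hS
  have hS1 : S ⊆ pairs C₁ := pairs_mono Finset.inter_subset_left
  have hS2 : S ⊆ pairs C₂ := pairs_mono Finset.inter_subset_right
  have hd12 : Disjoint (pairs C₁ \ S) (pairs C₂ \ S) := by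
    rw [Finset.disjoint_left]
    intro e he he'
    rw [Finset.mem_sdiff] at he he'
    exact he.2 (by rw [hS, pairs_inter]; exact Finset.mem_inter.2 ⟨he.1, he'.1⟩)
  have hu := pairs_subset_univ (n := n)
  set R : SimpleGraph (Fin n) → ℝ := fun G =>
    M.likelihood C₁ (pairs C₁ \ S) G * M.likelihood C₂ (pairs C₂ \ S) G with hR
  have hRn : ∀ G, 0 ≤ R G := fun G => mul_nonneg
    (likelihood_nonneg h₁ Finset.sdiff_subset G) (likelihood_nonneg h₂ Finset.sdiff_subset G)
  have hpt : ∀ G, Γ₁.indicator (M.likelihood C₁ (pairs C₁)) G *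
      Γ₂.indicator (M.likelihood C₂ (pairs C₂)) G ≤
      (κ₁ / 2) * (edgeProd S a₁ b₁ G * R G) + (κ₂ / 2) * (edgeProd S a₂ b₂ G * R G) := by
    intro G
    have hright : 0 ≤
        (κ₁ / 2) * (edgeProd S a₁ b₁ G * R G) + (κ₂ / 2) * (edgeProd S a₂ b₂ G * R G) := by
      have e1 := mul_nonneg (hn₁ G) (hRn G)
      have e2 := mul_nonneg (hn₂ G) (hRn G)
      nlinarith
    by_cases hG1 : G ∈ Γ₁
    · by_cases hG2 : G ∈ Γ₂
      · rw [Set.indicator_of_mem hG1, Set.indicator_of_mem hG2, likelihood_eq_mul hS1,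
          likelihood_eq_mul hS2]
        -- `x y ≤ (x² + y²)/2` separates the two communities, whose scaling factors may differ.
        have hmul : M.likelihood C₁ S G * M.likelihood C₂ S G ≤
            (κ₁ / 2) * edgeProd S a₁ b₁ G + (κ₂ / 2) * edgeProd S a₂ b₂ G := by
          nlinarith [hd₁ G hG1, hd₂ G hG2,
            sq_nonneg (M.likelihood C₁ S G - M.likelihood C₂ S G)]
        calc M.likelihood C₁ S G * M.likelihood C₁ (pairs C₁ \ S) G *
              (M.likelihood C₂ S G * M.likelihood C₂ (pairs C₂ \ S) G)
            = M.likelihood C₁ S G * M.likelihood C₂ S G * R G := by rw [hR]; ring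
          _ ≤ ((κ₁ / 2) * edgeProd S a₁ b₁ G + (κ₂ / 2) * edgeProd S a₂ b₂ G) * R G :=
              mul_le_mul_of_nonneg_right hmul (hRn G)
          _ = _ := by ring
      · rw [Set.indicator_of_notMem hG2, mul_zero]
        exact hright
    · rw [Set.indicator_of_notMem hG1, zero_mul]
      exact hright
  have hexp : ∀ a b : Fin n × Fin n → ℝ, expect M.p (fun G => edgeProd S a b G * R G) =
      ∏ e ∈ S, (M.p e.1 e.2 * a e + (1 - M.p e.1 e.2) * b e) := by
    intro a b
    have := expect_edgeProd_mul_mul M.p (S := S) (T := pairs C₁ \ S) (U := pairs C₂ \ S)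
      (hS1.trans (hu C₁)) (Finset.sdiff_subset.trans (hu C₁)) (Finset.sdiff_subset.trans (hu C₂))
      Finset.disjoint_sdiff Finset.disjoint_sdiff hd12 a b
      (fun _ => M.β C₁) (fun e => (1 - M.β C₁ * M.p e.1 e.2) / (1 - M.p e.1 e.2))
      (fun _ => M.β C₂) (fun e => (1 - M.β C₂ * M.p e.1 e.2) / (1 - M.p e.1 e.2))
    -- Off the overlap each likelihood factor has expectation 1.
    rw [prod_likelihood_eq_one fun e he => hp₁ e (Finset.sdiff_subset he),
      prod_likelihood_eq_one fun e he => hp₂ e (Finset.sdiff_subset he), mul_one, mul_one] at this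
    exact this
  refine (expect_mono M.p_nonneg M.p_le_one hpt).trans ?_
  rw [expect_add, expect_const_mul, expect_const_mul, hexp, hexp]
  linarith

/-- The truncated second moment method: the risk of every test is at least `1 - √(S + 2 b)`. -/
theorem one_sub_sqrt_le_risk (hn : 0 < n) (hrn : M.r ≤ n)
    (hp : ∀ C : Finset (Fin n), C.card = M.r → ∀ e ∈ pairs C, M.p e.1 e.2 < 1)
    (Γ : Finset (Fin n) → Set (SimpleGraph (Fin n))) {w : ℕ → ℝ} {b : ℝ}
    (hw : ∀ k, 0 ≤ w k) (hw0 : w 0 ≤ 1)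
    (hΓ : ∀ C : Finset (Fin n), C.card = M.r → prob (M.plantedP C) (Γ C)ᶜ ≤ b)
    (hSq : ∀ C : Finset (Fin n), C.card = M.r → ∀ D ⊆ C, M.SqBound C D (Γ C) (w D.card))
    (ψ : SimpleGraph (Fin n) → Bool) :
    1 - √(∑ k ∈ Finset.Icc 1 M.r, (M.r.choose k : ℝ) * ((M.r : ℝ) / n) ^ k * w k + 2 * b) ≤
      M.risk ψ := by
  set P := Finset.powersetCard M.r (Finset.univ : Finset (Fin n)) with hP
  have hPc : ∀ C ∈ P, C.card = M.r := fun C hC => (Finset.mem_powersetCard.1 hC).2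
  set N : ℝ := ((n.choose M.r : ℕ) : ℝ) with hN
  have hcard : (P.card : ℝ) = N := by
    rw [hP, Finset.card_powersetCard, Finset.card_univ, Fintype.card_fin]
  have hNpos : 0 < N := by
    rw [hN]; exact_mod_cast Nat.choose_pos hrn
  set s := ∑ k ∈ Finset.Icc 1 M.r, (M.r.choose k : ℝ) * ((M.r : ℝ) / n) ^ k * w k with hs
  set l : Finset (Fin n) → SimpleGraph (Fin n) → ℝ := fun C =>
    (Γ C).indicator (M.likelihood C (pairs C)) with hl
  have hl0 : ∀ C ∈ P, ∀ G, 0 ≤ l C G := fun C hC G =>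
    Set.indicator_nonneg (fun G _ => likelihood_nonneg (hPc C hC) le_rfl G) G
  set Lt : SimpleGraph (Fin n) → ℝ := fun G => N⁻¹ * ∑ C ∈ P, l C G with hLt
  have hfirst : 1 - b ≤ expect M.p Lt := by
    have hC : ∀ C ∈ P, 1 - b ≤ expect M.p (l C) := by
      intro C hC
      have h1 := hΓ C (hPc C hC)
      have h2 : expect M.p (l C) = prob (M.plantedP C) (Γ C) := by
        rw [prob_eq_expect, expect_plantedP (hp C (hPc C hC))]
        congr 1
        funext G
        by_cases hG : G ∈ Γ C <;> simp [hl, hG]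
      have h3 : prob (M.plantedP C) (Γ C) + prob (M.plantedP C) (Γ C)ᶜ = 1 := by
        rw [prob_eq_expect, prob_eq_expect, ← expect_add, ← expect_const (M.plantedP C) 1]
        congr 1
        funext G
        by_cases hG : G ∈ Γ C <;> simp [hG]
      linarith
    rw [hLt, expect_const_mul, expect_sum]
    have h4 := Finset.sum_le_sum hC
    rw [Finset.sum_const, nsmul_eq_mul, hcard] at h4
    calc 1 - b = N⁻¹ * (N * (1 - b)) := by field_simp
      _ ≤ _ := mul_le_mul_of_nonneg_left h4 (by positivity)
  have hsecond : expect M.p (fun G => Lt G ^ 2) ≤ 1 + s := by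
    have hpair : ∀ C ∈ P, ∀ C' ∈ P, expect M.p (fun G => l C G * l C' G) ≤ w (C ∩ C').card := by
      intro C hC C' hC'
      exact expect_mul_likelihood_le (hPc C hC) (hPc C' hC') (hp C (hPc C hC))
        (hp C' (hPc C' hC')) (hSq C (hPc C hC) _ Finset.inter_subset_left)
        (hSq C' (hPc C' hC') _ Finset.inter_subset_right)
    have hsq : (fun G => Lt G ^ 2) =
        fun G => (N⁻¹ * N⁻¹) * ∑ C ∈ P, ∑ C' ∈ P, l C G * l C' G := by
      funext G
      rw [← Finset.sum_mul_sum]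
      simp only [hLt]
      ring
    rw [hsq, expect_const_mul, expect_sum]
    have hsum : ∑ C ∈ P, expect M.p (fun G => ∑ C' ∈ P, l C G * l C' G) ≤ N * (N * (1 + s)) := by
      have : ∀ C ∈ P, expect M.p (fun G => ∑ C' ∈ P, l C G * l C' G) ≤ N * (1 + s) := by
        intro C hC
        rw [expect_sum]
        refine (Finset.sum_le_sum (hpair C hC)).trans
          ((sum_overlap_le hn hrn hw (hPc C hC)).trans ?_)
        exact mul_le_mul_of_nonneg_left (add_le_add hw0 le_rfl) hNpos.le
      refine (Finset.sum_le_sum this).trans ?_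
      rw [Finset.sum_const, nsmul_eq_mul, hcard]
    calc _ ≤ (N⁻¹ * N⁻¹) * (N * (N * (1 + s))) :=
          mul_le_mul_of_nonneg_left hsum (by positivity)
      _ = 1 + s := by field_simp
  set A : SimpleGraph (Fin n) → ℝ := Set.indicator {G | ψ G ≠ true} 1 with hA
  have hlow : 1 + expect M.p (fun G => (Lt G - 1) * A G) ≤ M.risk ψ := by
    have h1 : prob M.p {G | ψ G ≠ false} = 1 - expect M.p A := by
      rw [prob_eq_expect, ← expect_const M.p 1, ← expect_sub]
      congr 1
      funext G
      by_cases hG : ψ G = true <;> simp [hA, hG]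
    have h2 : expect M.p (fun G => Lt G * A G) ≤
        ⨆ C : {C : Finset (Fin n) // C.card = M.r}, prob (M.plantedP C) {G | ψ G ≠ true} := by
      set sup := ⨆ C : {C : Finset (Fin n) // C.card = M.r},
        prob (M.plantedP C) {G | ψ G ≠ true} with hsup
      have h3 : ∀ C ∈ P, expect M.p (fun G => l C G * A G) ≤ sup := by
        intro C hC
        have h4 : prob (M.plantedP C) {G | ψ G ≠ true} ≤ sup :=
          le_ciSup (f := fun C : {C : Finset (Fin n) // C.card = M.r} =>
            prob (M.plantedP C) {G | ψ G ≠ true}) (Set.finite_range _).bddAbove ⟨C, hPc C hC⟩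
        refine le_trans ?_ h4
        rw [prob_eq_expect, expect_plantedP (hp C (hPc C hC))]
        refine expect_mono M.p_nonneg M.p_le_one fun G => ?_
        refine mul_le_mul_of_nonneg_right ?_ (Set.indicator_nonneg (fun _ _ => zero_le_one) _)
        exact Set.indicator_le_self' (fun _ _ => likelihood_nonneg (hPc C hC) le_rfl _) _
      have h5 : (fun G => Lt G * A G) = fun G => N⁻¹ * ∑ C ∈ P, l C G * A G := by
        funext G
        rw [← Finset.sum_mul, ← mul_assoc]
      rw [h5, expect_const_mul, expect_sum]
      have h6 := Finset.sum_le_sum h3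
      rw [Finset.sum_const, nsmul_eq_mul, hcard] at h6
      calc _ ≤ N⁻¹ * (N * sup) := mul_le_mul_of_nonneg_left h6 (by positivity)
        _ = sup := by field_simp
    have h7 : expect M.p (fun G => (Lt G - 1) * A G) =
        expect M.p (fun G => Lt G * A G) - expect M.p A := by
      rw [← expect_sub]
      congr 1
      funext G
      ring
    unfold risk
    linarith
  have hvar : expect M.p (fun G => (Lt G - 1) * A G) ^ 2 ≤ s + 2 * b := by
    refine (sq_expect_le M.p_nonneg M.p_le_one _).trans ?_
    -- The expectation of the right side is at most `(1 + s) - 2 (1 - b) + 1 = s + 2 b`, because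
    -- truncation costs at most `b` in the mean of `Lt`.
    have h1 : ∀ G, ((Lt G - 1) * A G) ^ 2 ≤ (Lt G ^ 2 - 2 * Lt G) + 1 := by
      intro G
      by_cases hG : ψ G = true
      · have : A G = 0 := by simp [hA, hG]
        rw [this]
        nlinarith [sq_nonneg (Lt G - 1)]
      · have : A G = 1 := by simp [hA, hG]
        rw [this]
        nlinarith
    refine (expect_mono M.p_nonneg M.p_le_one h1).trans ?_
    rw [expect_add, expect_sub, expect_const_mul, expect_const]
    linarith
  have habs := Real.abs_le_sqrt hvar
  have := neg_abs_le (expect M.p (fun G => (Lt G - 1) * A G))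
  linarith

end Model

/-! ### Inequalities for the entropy function -/

section Entropy

theorem h_sub_one (β : ℝ) : h (β - 1) = β * Real.log β - (β - 1) := by
  simp [h]

/-- From `log β ≥ 2 (β - 1)/(β + 1)`, which gives `(β - 1)² ≤ (β + 1) h(β - 1)`. The constant 2 is
sharp as `β → 1`, as the untruncated sizes require. -/
theorem sq_sub_one_le_mul_h {β : ℝ} (hβ : 1 ≤ β) : (β - 1) ^ 2 ≤ 2 * β * h (β - 1) := by
  have hlog := Real.le_log_one_add_of_nonneg (sub_nonneg.2 hβ)
  rw [show 1 + (β - 1) = β by ring, show β - 1 + 2 = β + 1 by ring,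
    div_le_iff₀ (by linarith)] at hlog
  rw [h_sub_one]
  have h1 : 2 * (β * (β - 1)) ≤ β * Real.log β * (β + 1) := by nlinarith
  have h2 : (β - 1) ^ 2 ≤ (β * Real.log β - (β - 1)) * (β + 1) := by nlinarith
  have h3 : 0 ≤ β * Real.log β - (β - 1) := by
    by_contra hneg
    push Not at hneg
    nlinarith [sq_nonneg (β - 1)]
  nlinarith

theorem h_sub_one_nonneg {β : ℝ} (hβ : 1 ≤ β) : 0 ≤ h (β - 1) := by
  have := sq_sub_one_le_mul_h hβ
  by_contra hneg
  push Not at hneg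
  nlinarith [sq_nonneg (β - 1)]

/-- Turns the Bernstein fluctuation `√(β μ c) log β` into a quantity controlled by `μ h(β - 1)`.
Bounded `β` is handled by `log β ≤ β - 1`, large `β` by `β log β ≤ 2 h(β - 1)`. -/
theorem mul_log_sq_le {β : ℝ} (hβ : 1 ≤ β) :
    β * Real.log β ^ 2 ≤ 128 * (h (β - 1) * (1 + Real.log β)) := by
  have hlog := Real.log_nonneg hβ
  have hh := h_sub_one_nonneg hβ
  rcases le_total β 8 with h8 | h8
  · have h1 : Real.log β ≤ β - 1 := Real.log_le_sub_one_of_pos (by linarith)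
    have h2 : Real.log β ^ 2 ≤ (β - 1) ^ 2 := pow_le_pow_left₀ hlog h1 2
    have h3 : β * Real.log β ^ 2 ≤ 8 * (2 * 8 * h (β - 1)) := by
      refine mul_le_mul h8 (h2.trans ((sq_sub_one_le_mul_h hβ).trans ?_)) (sq_nonneg _) (by norm_num)
      nlinarith
    nlinarith [mul_nonneg hh hlog]
  · have h1 : (2 : ℝ) ≤ Real.log β := by
      have h2 : Real.log 8 ≤ Real.log β := Real.log_le_log (by norm_num) h8
      have h3 : Real.log 8 = 3 * Real.log 2 := by
        rw [show (8 : ℝ) = 2 ^ 3 by norm_num, Real.log_pow]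
        norm_num
      linarith [Real.log_two_gt_d9]
    have h2 : β * Real.log β ≤ 2 * h (β - 1) := by
      rw [h_sub_one]
      nlinarith
    nlinarith [mul_nonneg hh hlog]

/-- The exponent of the truncated second moment of the likelihood ratio on `k` vertices. -/
theorem truncated_exponent_le {ε η β μ k L ℓ lam : ℝ} (hε0 : 0 < ε) (hε1 : ε < 1)
    (hη : η ≤ ε / 32) (hβ : 1 ≤ β) (hμ : 0 ≤ μ) (hk : 0 ≤ k) (hℓ : 0 ≤ ℓ) (hlam : 0 ≤ lam)
    (hμh : μ * h (β - 1) ≤ (1 - ε) * (k * L)) (hL : L ≤ (1 + ε ^ 2 / 2 ^ 20) * ℓ)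
    (hlam₁ : lam ≤ ε ^ 2 / 2 ^ 20 * ℓ) (hlam₂ : lam * Real.log β ≤ ε ^ 2 / 2 ^ 20 * ℓ) :
    (1 + 4 * η) * h (β - 1) * μ + (2 * (k * lam) + 2 * √(β * μ * (k * lam))) * Real.log β ≤
      k * ((1 - ε / 2) * ℓ) := by
  have hlog := Real.log_nonneg hβ
  have hh := h_sub_one_nonneg hβ
  have hkℓ : 0 ≤ k * ℓ := mul_nonneg hk hℓ
  have hζ : ε ^ 2 / 2 ^ 20 ≤ ε / 2 ^ 20 := by
    refine div_le_div_of_nonneg_right ?_ (by norm_num)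
    nlinarith
  have hkL : k * L ≤ (1 + ε / 2 ^ 20) * (k * ℓ) := by
    calc k * L ≤ k * ((1 + ε ^ 2 / 2 ^ 20) * ℓ) := mul_le_mul_of_nonneg_left hL hk
      _ = (1 + ε ^ 2 / 2 ^ 20) * (k * ℓ) := by ring
      _ ≤ _ := mul_le_mul_of_nonneg_right (by linarith) hkℓ
  have hμh' : μ * h (β - 1) ≤ (1 - ε) * ((1 + ε / 2 ^ 20) * (k * ℓ)) :=
    hμh.trans (mul_le_mul_of_nonneg_left hkL (by linarith))
  have hμh0 : 0 ≤ μ * h (β - 1) := mul_nonneg hμ hh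
  have hfirst : (1 + 4 * η) * h (β - 1) * μ ≤ (1 - 2 * ε / 3) * (k * ℓ) := by
    have h1 : (1 + 4 * η) * h (β - 1) * μ ≤ (1 + ε / 8) * (μ * h (β - 1)) := by nlinarith
    have h2 : (1 + ε / 8) * (μ * h (β - 1)) ≤
        (1 + ε / 8) * ((1 - ε) * ((1 + ε / 2 ^ 20) * (k * ℓ))) :=
      mul_le_mul_of_nonneg_left hμh' (by linarith)
    have h3 : (1 + ε / 8) * ((1 - ε) * (1 + ε / 2 ^ 20)) ≤ 1 - 2 * ε / 3 := by nlinarith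
    have h4 := mul_le_mul_of_nonneg_right h3 hkℓ
    linarith
  have hsecond : 2 * (k * lam) * Real.log β ≤ ε / 16 * (k * ℓ) := by
    have h1 : k * (lam * Real.log β) ≤ k * (ε ^ 2 / 2 ^ 20 * ℓ) :=
      mul_le_mul_of_nonneg_left hlam₂ hk
    have h2 : ε ^ 2 / 2 ^ 20 * (k * ℓ) ≤ ε / 2 ^ 20 * (k * ℓ) :=
      mul_le_mul_of_nonneg_right hζ hkℓ
    nlinarith
  -- The square root is why the smallness assumptions are of order `ε²`: under it, `μ h(β - 1)` is
  -- of order `k ℓ` and `k λ (1 + log β)` of order `ε² k ℓ`.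
  have hthird : √(β * μ * (k * lam)) * Real.log β ≤ ε / 32 * (k * ℓ) := by
    have h1 : √(β * μ * (k * lam)) * Real.log β = √(β * μ * (k * lam) * Real.log β ^ 2) := by
      rw [Real.sqrt_mul (show 0 ≤ β * μ * (k * lam) by positivity) (Real.log β ^ 2), Real.sqrt_sq hlog]
    rw [h1]
    refine Real.sqrt_le_iff.2 ⟨by positivity, ?_⟩
    have h2 : μ * (k * lam) * (β * Real.log β ^ 2) ≤
        μ * (k * lam) * (128 * (h (β - 1) * (1 + Real.log β))) :=
      mul_le_mul_of_nonneg_left (mul_log_sq_le hβ) (by positivity)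
    have h3 : μ * h (β - 1) ≤ 2 * (k * ℓ) := by
      refine hμh'.trans ?_
      have : (1 - ε) * (1 + ε / 2 ^ 20) ≤ 2 := by nlinarith
      have := mul_le_mul_of_nonneg_right this hkℓ
      linarith
    have h4 : k * (lam + lam * Real.log β) ≤ 2 * (ε ^ 2 / 2 ^ 20) * (k * ℓ) := by
      have := mul_le_mul_of_nonneg_left (add_le_add hlam₁ hlam₂) hk
      linarith
    have h5 : (μ * h (β - 1)) * (k * (lam + lam * Real.log β)) ≤
        (2 * (k * ℓ)) * (2 * (ε ^ 2 / 2 ^ 20) * (k * ℓ)) :=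
      mul_le_mul h3 h4 (by positivity) (by positivity)
    calc β * μ * (k * lam) * Real.log β ^ 2 = μ * (k * lam) * (β * Real.log β ^ 2) := by ring
      _ ≤ _ := h2
      _ = 128 * ((μ * h (β - 1)) * (k * (lam + lam * Real.log β))) := by ring
      _ ≤ 128 * ((2 * (k * ℓ)) * (2 * (ε ^ 2 / 2 ^ 20) * (k * ℓ))) :=
          mul_le_mul_of_nonneg_left h5 (by norm_num)
      _ ≤ (ε / 32 * (k * ℓ)) ^ 2 := by nlinarith [sq_nonneg (ε * (k * ℓ))]
  have : (2 * (k * lam) + 2 * √(β * μ * (k * lam))) * Real.log β =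
      2 * (k * lam) * Real.log β + 2 * (√(β * μ * (k * lam)) * Real.log β) := by ring
  rw [this]
  nlinarith [mul_nonneg hε0.le hkℓ]

end Entropy

/-! ### Upper tails of edge counts -/

section Tails

variable {n : ℕ} {q : Fin n → Fin n → ℝ}

/-- Chernoff's bound, with `exp θ ≤ 1 + θ + θ²` on `[0, 1]`. -/
theorem prob_edgeCount_gt_le_exp (h0 : ∀ i j, i ≠ j → 0 ≤ q i j) (h1 : ∀ i j, i ≠ j → q i j ≤ 1)
    (D : Finset (Fin n)) {θ : ℝ} (hθ0 : 0 ≤ θ) (hθ1 : θ ≤ 1) (x : ℝ) :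
    prob q {G | x < edgeCount D G} ≤
      Real.exp ((∑ e ∈ pairs D, q e.1 e.2) * (θ + θ ^ 2) - θ * x) := by
  have hpt : ∀ G : SimpleGraph (Fin n), Set.indicator {G | x < edgeCount D G} 1 G ≤
      Real.exp (-(θ * x)) * edgeProd (pairs D) (fun _ => Real.exp θ) (fun _ => 1) G := by
    intro G
    rw [edgeProd_const_one, ← Real.exp_nat_mul, ← Real.exp_add]
    refine Set.indicator_apply_le' (fun hG => ?_) fun _ => (Real.exp_pos _).le
    refine Real.one_le_exp ?_
    have : x < edgeCount D G := hG
    nlinarith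
  rw [prob_eq_expect]
  refine (expect_mono h0 h1 hpt).trans ?_
  rw [expect_const_mul, expect_edgeProd q (pairs_subset_univ D), sub_eq_neg_add, Real.exp_add]
  refine mul_le_mul_of_nonneg_left ?_ (Real.exp_pos _).le
  rw [Finset.sum_mul, Real.exp_sum]
  refine Finset.prod_le_prod (fun e he => ?_) fun e he => ?_
  · have hne := (mem_pairs.1 he).2.2.ne
    have := h0 _ _ hne
    have := h1 _ _ hne
    have := Real.exp_pos θ
    nlinarith [mul_nonneg (h0 _ _ hne) this.le]
  · have hne := (mem_pairs.1 he).2.2.ne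
    have hexp : Real.exp θ - 1 - θ ≤ θ ^ 2 :=
      (le_abs_self _).trans (Real.abs_exp_sub_one_sub_id_le (by rwa [abs_of_nonneg hθ0]))
    have := Real.add_one_le_exp (q e.1 e.2 * (θ + θ ^ 2))
    nlinarith [mul_le_mul_of_nonneg_left hexp (h0 _ _ hne)]

/-- Bernstein's inequality for the number of edges in `D`. -/
theorem prob_edgeCount_gt_le (h0 : ∀ i j, i ≠ j → 0 ≤ q i j) (h1 : ∀ i j, i ≠ j → q i j ≤ 1)
    (D : Finset (Fin n)) {m c : ℝ} (hm : ∑ e ∈ pairs D, q e.1 e.2 = m) (hc : 0 ≤ c) :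
    prob q {G | m + 2 * c + 2 * √(m * c) < edgeCount D G} ≤ Real.exp (-c) := by
  have hm0 : 0 ≤ m := by
    rw [← hm]
    exact Finset.sum_nonneg fun e he => h0 _ _ (mem_pairs.1 he).2.2.ne
  rcases hc.eq_or_lt with rfl | hcpos
  · simpa using prob_le_one h0 h1 _
  have hs := Real.sqrt_nonneg (m * c)
  rcases le_or_gt c m with hcm | hcm
  · have hmpos : 0 < m := hcpos.trans_le hcm
    -- Chosen so that `m t² = c`; when `c > m` it would exceed 1, and `θ = 1` is used instead.
    set t := √(c / m) with ht
    have ht0 : 0 ≤ t := Real.sqrt_nonneg _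
    have ht2 : m * t ^ 2 = c := by
      rw [ht, Real.sq_sqrt (by positivity)]
      field_simp
    have ht1 : t ≤ 1 := Real.sqrt_le_one.2 ((div_le_one hmpos).2 hcm)
    have hsq : √(m * c) = m * t := by
      rw [← ht2, show m * (m * t ^ 2) = (m * t) ^ 2 by ring, Real.sqrt_sq (by positivity)]
    refine (prob_edgeCount_gt_le_exp h0 h1 D ht0 ht1 _).trans (Real.exp_le_exp.2 ?_)
    rw [hm, hsq]
    nlinarith [mul_nonneg ht0 hc]
  · refine (prob_edgeCount_gt_le_exp h0 h1 D zero_le_one le_rfl _).trans (Real.exp_le_exp.2 ?_)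
    rw [hm]
    nlinarith

end Tails

/-! ### Second moment on an overlap, with and without truncation -/

namespace Model

variable {n : ℕ} {M : Model n} {C D : Finset (Fin n)} {η : ℝ}

theorem p_le_of_sq_mul_le (hC : C.card = M.r)
    (hs : ∀ i ∈ C, ∀ j ∈ C, i ≠ j → M.β C ^ 2 * M.p i j ≤ η) {e : Fin n × Fin n}
    (he : e ∈ pairs C) :
    0 ≤ M.p e.1 e.2 ∧ M.p e.1 e.2 ≤ M.β C * M.p e.1 e.2 ∧ M.β C * M.p e.1 e.2 ≤ η := by
  have h1 := mem_pairs.1 he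
  have h2 := M.p_nonneg _ _ h1.2.2.ne
  have h3 := hs _ h1.1 _ h1.2.1 h1.2.2.ne
  have h4 := M.one_le_β C hC
  refine ⟨h2, by nlinarith, ?_⟩
  nlinarith [mul_nonneg (sub_nonneg.2 h4) (mul_nonneg (zero_le_one.trans h4) h2)]

theorem likelihood_sq (S : Finset (Fin n × Fin n)) (G : SimpleGraph (Fin n)) :
    M.likelihood C S G ^ 2 = edgeProd S (fun _ => M.β C * M.β C)
      (fun e => ((1 - M.β C * M.p e.1 e.2) / (1 - M.p e.1 e.2)) ^ 2) G := by
  unfold likelihood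
  rw [sq, edgeProd_mul]
  simp only [sq]

/-- In the squared likelihood, one of the two factors `β ^ e(D)` is replaced by its maximum `β ^ x`
on the event. The rest has expectation about `exp (-(β - 1) E₀[e(D)])`, and `β log β - (β - 1) = h(β
- 1)`. -/
theorem sqBound_of_edgeCount_le (hC : C.card = M.r) (hD : D ⊆ C) (hη : η ≤ 1 / 2)
    (hs : ∀ i ∈ C, ∀ j ∈ C, i ≠ j → M.β C ^ 2 * M.p i j ≤ η)
    {Γ : Set (SimpleGraph (Fin n))} {x : ℝ} (hΓ : ∀ G ∈ Γ, (edgeCount D G : ℝ) ≤ x) :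
    M.SqBound C D Γ (Real.exp ((1 + 4 * η) * h (M.β C - 1) * M.expEdges D +
      (x - M.β C * M.expEdges D) * Real.log (M.β C))) := by
  have hβ := M.one_le_β C hC
  have hβ0 : 0 < M.β C := by linarith
  have hlog := Real.log_nonneg hβ
  have hnn : ∀ G, 0 ≤ edgeProd (pairs D) (fun _ => M.β C)
      (fun e => ((1 - M.β C * M.p e.1 e.2) / (1 - M.p e.1 e.2)) ^ 2) G := fun G =>
    edgeProd_nonneg (fun _ _ => hβ0.le) (fun _ _ => sq_nonneg _) G
  refine ⟨Real.exp (x * Real.log (M.β C)), fun _ => M.β C,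
    fun e => ((1 - M.β C * M.p e.1 e.2) / (1 - M.p e.1 e.2)) ^ 2, fun G =>
    mul_nonneg (Real.exp_pos _).le (hnn G), fun G hG => ?_, ?_⟩
  · rw [likelihood_sq]
    have h1 := edgeProd_mul (pairs D) (fun _ => M.β C) (fun _ => 1) (fun _ => M.β C)
      (fun e => ((1 - M.β C * M.p e.1 e.2) / (1 - M.p e.1 e.2)) ^ 2) G
    simp only [one_mul] at h1
    rw [← h1]
    refine mul_le_mul_of_nonneg_right ?_ (hnn G)
    rw [edgeProd_const_one]
    calc M.β C ^ edgeCount D G = Real.exp (edgeCount D G * Real.log (M.β C)) := by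
          rw [Real.exp_nat_mul, Real.exp_log hβ0]
      _ ≤ _ := Real.exp_le_exp.2 (mul_le_mul_of_nonneg_right (hΓ G hG) hlog)
  · have hprod : ∏ e ∈ pairs D, (M.p e.1 e.2 * M.β C + (1 - M.p e.1 e.2) *
        ((1 - M.β C * M.p e.1 e.2) / (1 - M.p e.1 e.2)) ^ 2) ≤
        Real.exp ((4 * η * h (M.β C - 1) - (M.β C - 1)) * M.expEdges D) := by
      rw [expEdges_eq_sum, Finset.mul_sum, Real.exp_sum]
      refine Finset.prod_le_prod (fun e he => ?_) fun e he => ?_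
      · obtain ⟨h1, h2, h3⟩ := p_le_of_sq_mul_le hC hs (pairs_mono hD he)
        have h4 : 0 ≤ 1 - M.p e.1 e.2 := by linarith
        positivity
      · obtain ⟨h1, h2, h3⟩ := p_le_of_sq_mul_le hC hs (pairs_mono hD he)
        set p := M.p e.1 e.2
        set β := M.β C
        have h4 : 0 < 1 - p := by linarith
        have h5 : p * β + (1 - p) * ((1 - β * p) / (1 - p)) ^ 2 =
            1 + p - β * p + (β - 1) ^ 2 * p ^ 2 / (1 - p) := by
          field_simp
          ring
        have hh := h_sub_one_nonneg hβ
        -- The second-order term is absorbed using `β p ≤ η`, a consequence of sparsity.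
        have h6 : (β - 1) ^ 2 * p ^ 2 / (1 - p) ≤ 4 * η * h (β - 1) * p := by
          rw [div_le_iff₀ h4]
          calc (β - 1) ^ 2 * p ^ 2 ≤ 2 * β * h (β - 1) * p ^ 2 :=
                mul_le_mul_of_nonneg_right (sq_sub_one_le_mul_h hβ) (sq_nonneg p)
            _ = (β * p) * (2 * h (β - 1) * p) := by ring
            _ ≤ η * (2 * h (β - 1) * p) := mul_le_mul_of_nonneg_right h3 (by positivity)
            _ = (4 * η * h (β - 1) * p) * (1 / 2) := by ring
            _ ≤ _ := by
                refine mul_le_mul_of_nonneg_left (by linarith) ?_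
                have : 0 ≤ η := by linarith
                positivity
        rw [h5]
        refine le_trans ?_ (Real.add_one_le_exp _)
        nlinarith
    refine (mul_le_mul_of_nonneg_left hprod (Real.exp_pos _).le).trans (le_of_eq ?_)
    rw [← Real.exp_add, h_sub_one]
    congr 1
    ring

theorem sqBound_of_sparse (hC : C.card = M.r) (hD : D ⊆ C) (hη : η ≤ 1 / 2)
    (hs : ∀ i ∈ C, ∀ j ∈ C, i ≠ j → M.β C ^ 2 * M.p i j ≤ η) (Γ : Set (SimpleGraph (Fin n))) :
    M.SqBound C D Γ (Real.exp ((1 + 2 * η) * (M.β C - 1) ^ 2 * M.expEdges D)) := by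
  have hβ := M.one_le_β C hC
  refine ⟨1, fun _ => M.β C * M.β C,
    fun e => ((1 - M.β C * M.p e.1 e.2) / (1 - M.p e.1 e.2)) ^ 2, fun G => ?_, fun G _ => ?_, ?_⟩
  · rw [← likelihood_sq, one_mul]
    exact sq_nonneg _
  · rw [likelihood_sq, one_mul]
  · rw [one_mul, expEdges_eq_sum, Finset.mul_sum, Real.exp_sum]
    refine Finset.prod_le_prod (fun e he => ?_) fun e he => ?_
    · obtain ⟨h1, h2, h3⟩ := p_le_of_sq_mul_le hC hs (pairs_mono hD he)
      have h4 : 0 ≤ 1 - M.p e.1 e.2 := by linarith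
      positivity
    · obtain ⟨h1, h2, h3⟩ := p_le_of_sq_mul_le hC hs (pairs_mono hD he)
      set p := M.p e.1 e.2
      set β := M.β C
      have h4 : 0 < 1 - p := by linarith
      have h5 : p * (β * β) + (1 - p) * ((1 - β * p) / (1 - p)) ^ 2 =
          1 + (β - 1) ^ 2 * p * (1 / (1 - p)) := by
        field_simp
        ring
      have h6 : 1 / (1 - p) ≤ 1 + 2 * η := by
        rw [div_le_iff₀ h4]
        nlinarith
      rw [h5]
      refine le_trans ?_ (Real.add_one_le_exp _)
      have := mul_le_mul_of_nonneg_left h6 (mul_nonneg (sq_nonneg (β - 1)) h1)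
      linarith

end Model

/-! ### Geometric sums, binomial and union bounds -/

theorem sum_pow_Icc_le {x : ℝ} (hx0 : 0 ≤ x) (hx : x ≤ 1 / 2) (r : ℕ) :
    ∑ k ∈ Finset.Icc 1 r, x ^ k ≤ 2 * x := by
  have key : (1 - x) * ∑ k ∈ Finset.Icc 1 r, x ^ k = x - x ^ (r + 1) := by
    induction r with
    | zero => simp
    | succ r ih =>
      rw [Finset.sum_Icc_succ_top (by omega), mul_add, ih]
      ring
  have h1 : 0 ≤ x ^ (r + 1) := by positivity
  have h2 : 0 ≤ ∑ k ∈ Finset.Icc 1 r, x ^ k := Finset.sum_nonneg fun k _ => by positivity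
  nlinarith

/-- The bound `(e r / k)^k`, from `k^k / k! ≤ e^k`. -/
theorem choose_le_exp {r k : ℕ} (hk : 0 < k) (hr : 0 < r) :
    (r.choose k : ℝ) ≤ Real.exp (k * (1 + Real.log ((r : ℝ) / k))) := by
  have hk' : (0 : ℝ) < k := by exact_mod_cast hk
  have hr' : (0 : ℝ) < r := by exact_mod_cast hr
  have hf : (0 : ℝ) < k.factorial := by exact_mod_cast k.factorial_pos
  have h1 : (r.choose k : ℝ) ≤ (r : ℝ) ^ k / k.factorial := Nat.choose_le_pow_div k r
  have h2 : (k : ℝ) ^ k / k.factorial ≤ Real.exp k := Real.pow_div_factorial_le_exp k hk'.le k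
  have h3 : Real.exp (k * (1 + Real.log ((r : ℝ) / k))) = Real.exp k * ((r : ℝ) / k) ^ k := by
    rw [mul_add, Real.exp_add, mul_one, Real.exp_nat_mul, Real.exp_log (by positivity)]
  rw [h3]
  calc (r.choose k : ℝ) ≤ (r : ℝ) ^ k / k.factorial := h1
    _ = (k : ℝ) ^ k / k.factorial * ((r : ℝ) / k) ^ k := by
        rw [div_pow]
        field_simp
    _ ≤ _ := mul_le_mul_of_nonneg_right h2 (by positivity)

theorem prob_iUnion_le {n : ℕ} {q : Fin n → Fin n → ℝ} (h0 : ∀ i j, i ≠ j → 0 ≤ q i j)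
    (h1 : ∀ i j, i ≠ j → q i j ≤ 1) {ι : Type*} (s : Finset ι)
    (A : ι → Set (SimpleGraph (Fin n))) {B : Set (SimpleGraph (Fin n))}
    (hB : ∀ G ∈ B, ∃ i ∈ s, G ∈ A i) : prob q B ≤ ∑ i ∈ s, prob q (A i) := by
  simp only [prob_eq_expect]
  rw [← expect_sum]
  refine expect_mono h0 h1 fun G => ?_
  have hnn : ∀ i ∈ s, (0 : ℝ) ≤ (A i).indicator 1 G := fun i _ =>
    Set.indicator_nonneg (fun _ _ => zero_le_one) G
  refine Set.indicator_apply_le' (fun hG => ?_) fun _ => Finset.sum_nonneg hnn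
  obtain ⟨i, hi, hGi⟩ := hB G hG
  refine le_trans ?_ (Finset.single_le_sum hnn hi)
  simp [hGi]

/-! ### Typical events and the non-asymptotic risk bound -/

namespace Model

variable {n : ℕ} {M : Model n}

theorem sum_plantedP (C : Finset (Fin n)) {D : Finset (Fin n)} (hD : D ⊆ C) :
    ∑ e ∈ pairs D, M.plantedP C e.1 e.2 = M.β C * M.expEdges D := by
  rw [expEdges_eq_sum, Finset.mul_sum]
  exact Finset.sum_congr rfl fun e he => plantedP_of_mem_pairs (pairs_mono hD he)

/-- The threshold for the number of edges in a set `D` of a planted community `C`, at the level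
`exp (-c)` with `c = |D| λ`. -/
def threshold (M : Model n) (C D : Finset (Fin n)) (lam : ℝ) : ℝ :=
  M.β C * M.expEdges D + 2 * (D.card * lam) + 2 * √(M.β C * M.expEdges D * (D.card * lam))

/-- The event that no set `D ⊆ C` with size in `T` has too many edges. -/
def typical (M : Model n) (C : Finset (Fin n)) (T : ℕ → Prop) (lam : ℝ) :
    Set (SimpleGraph (Fin n)) :=
  {G | ∀ D ⊆ C, D.Nonempty → T D.card → (edgeCount D G : ℝ) ≤ M.threshold C D lam}

theorem prob_compl_typical_le {C : Finset (Fin n)} (hC : C.card = M.r) {T : ℕ → Prop} {lam κ : ℝ}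
    (hlam : 0 ≤ lam)
    (hT : ∀ k : ℕ, 0 < k → k ≤ M.r → T k → 1 + Real.log ((M.r : ℝ) / k) + κ ≤ lam) :
    prob (M.plantedP C) (M.typical C T lam)ᶜ ≤ ∑ k ∈ Finset.Icc 1 M.r, Real.exp (-κ) ^ k := by
  have h0 := plantedP_nonneg hC
  have h1 := plantedP_le_one hC
  set s := C.powerset.filter fun D => D.Nonempty ∧ T D.card with hs
  have hunion := prob_iUnion_le h0 h1 s (B := (M.typical C T lam)ᶜ)
    (fun D => {G | M.threshold C D lam < edgeCount D G}) (by
      intro G hG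
      simp only [typical, Set.mem_compl_iff, Set.mem_ofPred_eq] at hG
      push Not at hG
      obtain ⟨D, hD, hne, hTD, hlt⟩ := hG
      exact ⟨D, Finset.mem_filter.2 ⟨Finset.mem_powerset.2 hD, hne, hTD⟩, hlt⟩)
  refine hunion.trans ?_
  -- Vanishing at `k = 0` lets the sum over all subsets of `C` start at size 1.
  set f : ℕ → ℝ := fun k => if 0 < k ∧ T k then Real.exp (-(k * lam)) else 0 with hf
  have hterm : ∀ D ∈ s, prob (M.plantedP C) {G | M.threshold C D lam < edgeCount D G} ≤
      f D.card := by
    intro D hD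
    obtain ⟨hDC, hne, hTD⟩ := Finset.mem_filter.1 hD
    rw [hf]
    simp only [hne.card_pos, hTD, and_self, if_true]
    exact prob_edgeCount_gt_le h0 h1 D (sum_plantedP C (Finset.mem_powerset.1 hDC)) (by positivity)
  have hf0 : ∀ k, 0 ≤ f k := by
    intro k
    simp only [hf]
    split_ifs
    exacts [(Real.exp_pos _).le, le_rfl]
  calc ∑ D ∈ s, prob (M.plantedP C) {G | M.threshold C D lam < edgeCount D G}
      ≤ ∑ D ∈ s, f D.card := Finset.sum_le_sum hterm
    _ ≤ ∑ D ∈ C.powerset, f D.card :=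
        Finset.sum_le_sum_of_subset_of_nonneg (Finset.filter_subset _ _) fun D _ _ => hf0 _
    _ = ∑ k ∈ Finset.range (M.r + 1), (M.r.choose k) • f k := by
        rw [Finset.sum_powerset_apply_card, hC]
    _ = ∑ k ∈ Finset.Icc 1 M.r, (M.r.choose k) • f k := by
        symm
        refine Finset.sum_subset (fun k hk => ?_) fun k hk hk' => ?_
        · have := Finset.mem_Icc.1 hk
          exact Finset.mem_range.2 (by omega)
        · have h2 : k = 0 := by
            have := Finset.mem_range.1 hk
            by_contra hne
            exact hk' (Finset.mem_Icc.2 ⟨by omega, by omega⟩)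
          simp [hf, h2]
    _ ≤ _ := by
        refine Finset.sum_le_sum fun k hk => ?_
        have hk' := Finset.mem_Icc.1 hk
        rw [← Real.exp_nat_mul, nsmul_eq_mul]
        by_cases hTk : T k
        · have hkpos : 0 < k := hk'.1
          simp only [hf, hkpos, hTk, and_self, if_true]
          refine (mul_le_mul_of_nonneg_right (choose_le_exp hk'.1 (hkpos.trans_le hk'.2))
            (Real.exp_pos _).le).trans ?_
          rw [← Real.exp_add]
          refine Real.exp_le_exp.2 ?_
          have := mul_le_mul_of_nonneg_left (hT k hkpos hk'.2 hTk) (Nat.cast_nonneg (α := ℝ) k)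
          linarith
        · simp only [hf, hTk, and_false, if_false, mul_zero]
          exact (Real.exp_pos _).le

/-- Every test has risk at least `1 - √(6 e^{-κ})`, if overlaps of `k` vertices contribute at most
`exp (k A_k)` to the truncated second moment. The sizes in `T` are those for which the number of
edges is truncated. -/
theorem one_sub_sqrt_exp_le_risk {T : ℕ → Prop} {A : ℕ → ℝ} {lam κ η : ℝ} (hr : 0 < M.r)
    (hrn : M.r ≤ n) (hη : η ≤ 1 / 2) (hlam : 0 ≤ lam) (hκ : Real.log 2 ≤ κ)
    (hs : ∀ C : Finset (Fin n), C.card = M.r →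
      ∀ i ∈ C, ∀ j ∈ C, i ≠ j → M.β C ^ 2 * M.p i j ≤ η)
    (htrunc : ∀ C : Finset (Fin n), C.card = M.r → ∀ D ⊆ C, D.Nonempty → T D.card →
      (1 + 4 * η) * h (M.β C - 1) * M.expEdges D +
        (2 * (D.card * lam) + 2 * √(M.β C * M.expEdges D * (D.card * lam))) * Real.log (M.β C) ≤
          D.card * A D.card)
    (hfull : ∀ C : Finset (Fin n), C.card = M.r → ∀ D ⊆ C, D.Nonempty → ¬ T D.card →
      (1 + 2 * η) * (M.β C - 1) ^ 2 * M.expEdges D ≤ D.card * A D.card)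
    (hcount : ∀ k : ℕ, 0 < k → k ≤ M.r →
      1 + Real.log ((M.r : ℝ) / k) + A k + κ ≤ Real.log ((n : ℝ) / M.r))
    (hT : ∀ k : ℕ, 0 < k → k ≤ M.r → T k → 1 + Real.log ((M.r : ℝ) / k) + κ ≤ lam)
    (ψ : SimpleGraph (Fin n) → Bool) :
    1 - √(6 * Real.exp (-κ)) ≤ M.risk ψ := by
  have hn : 0 < n := hr.trans_le hrn
  have hx : Real.exp (-κ) ≤ 1 / 2 := by
    calc Real.exp (-κ) ≤ Real.exp (-Real.log 2) := Real.exp_le_exp.2 (neg_le_neg hκ)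
      _ = 1 / 2 := by rw [Real.exp_neg, Real.exp_log (by norm_num)]; norm_num
  have hgeom := sum_pow_Icc_le (Real.exp_pos (-κ)).le hx M.r
  have hp : ∀ C : Finset (Fin n), C.card = M.r → ∀ e ∈ pairs C, M.p e.1 e.2 < 1 := by
    intro C hC e he
    obtain ⟨_, h2, h3⟩ := p_le_of_sq_mul_le hC (hs C hC) he
    linarith
  have key := one_sub_sqrt_le_risk hn hrn hp (fun C => M.typical C T lam)
    (w := fun k => Real.exp (k * A k)) (fun k => (Real.exp_pos _).le) (by simp)
    (fun C hC => prob_compl_typical_le hC hlam hT) (by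
      intro C hC D hD
      have mono : ∀ {u v : ℝ}, u ≤ v → M.SqBound C D (M.typical C T lam) u →
          M.SqBound C D (M.typical C T lam) v := by
        rintro u v huv ⟨κ', a, b, e1, e2, e3⟩
        exact ⟨κ', a, b, e1, e2, e3.trans huv⟩
      rcases D.eq_empty_or_nonempty with rfl | hne
      · refine ⟨1, fun _ => 1, fun _ => 1, fun G => ?_, fun G _ => ?_, ?_⟩ <;>
          simp [likelihood, edgeProd, pairs_empty]
      · by_cases hTD : T D.card
        · refine mono (Real.exp_le_exp.2 ?_) (sqBound_of_edgeCount_le hC hD hη (hs C hC)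
            (x := M.threshold C D lam) fun G hG => hG D hD hne hTD)
          refine le_trans (le_of_eq ?_) (htrunc C hC D hD hne hTD)
          unfold threshold
          ring
        · exact mono (Real.exp_le_exp.2 (hfull C hC D hD hne hTD))
            (sqBound_of_sparse hC hD hη (hs C hC) _)) ψ
  -- With `x = exp (-κ)`, both the overlap sum and the truncation error are at most `2 x`, whence `2
  -- x + 2 (2 x) = 6 x`.
  refine le_trans ?_ key
  refine sub_le_sub_left (Real.sqrt_le_sqrt ?_) 1
  have hsum : ∑ k ∈ Finset.Icc 1 M.r,
      (M.r.choose k : ℝ) * ((M.r : ℝ) / n) ^ k * Real.exp (k * A k) ≤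
        ∑ k ∈ Finset.Icc 1 M.r, Real.exp (-κ) ^ k := by
    refine Finset.sum_le_sum fun k hk => ?_
    have hk' := Finset.mem_Icc.1 hk
    have hr' : (0 : ℝ) < M.r := by exact_mod_cast hr
    have hn' : (0 : ℝ) < n := by exact_mod_cast hn
    have hpow : ((M.r : ℝ) / n) ^ k = Real.exp (k * -Real.log ((n : ℝ) / M.r)) := by
      rw [Real.exp_nat_mul, Real.exp_neg, Real.exp_log (by positivity), inv_div]
    rw [hpow, ← Real.exp_nat_mul]
    calc _ ≤ Real.exp (k * (1 + Real.log ((M.r : ℝ) / k))) *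
          Real.exp (k * -Real.log ((n : ℝ) / M.r)) * Real.exp (k * A k) := by
          gcongr
          exact choose_le_exp hk'.1 hr
      _ ≤ _ := by
          rw [← Real.exp_add, ← Real.exp_add]
          refine Real.exp_le_exp.2 ?_
          have := mul_le_mul_of_nonneg_left (hcount k hk'.1 hk'.2) (Nat.cast_nonneg (α := ℝ) k)
          linarith
  linarith

theorem risk_false_le_one (M : Model n) : M.risk (fun _ => false) ≤ 1 := by
  unfold risk
  have h1 : prob M.p {G | (fun _ : SimpleGraph (Fin n) => false) G ≠ false} = 0 := by
    simp [prob]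
  rw [h1, zero_add]
  -- This also covers `r > n`, where the supremum is over an empty type and equals 0.
  exact Real.iSup_le (fun C => prob_le_one (plantedP_nonneg C.2) (plantedP_le_one C.2) _)
    zero_le_one

theorem minimaxRisk_le_one (M : Model n) : M.minimaxRisk ≤ 1 :=
  (ciInf_le (Set.finite_range _).bddBelow _).trans M.risk_false_le_one

theorem expEdges_eq_avgP_mul (D : Finset (Fin n)) :
    M.expEdges D = M.avgP D * ((D.card : ℝ) * (D.card - 1) / 2) := by
  rw [avgP, ← Nat.cast_choose_two]
  rcases Nat.eq_zero_or_pos (D.card.choose 2) with h0 | hpos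
  · have : pairs D = ∅ := by rw [← Finset.card_eq_zero, card_pairs, h0]
    rw [expEdges_eq_sum, this]
    simp
  · rw [div_mul_cancel₀]
    exact_mod_cast hpos.ne'

theorem sq_mul_avgP_le {C : Finset (Fin n)} {η : ℝ} (hη : 0 ≤ η)
    (hs : ∀ i ∈ C, ∀ j ∈ C, i ≠ j → M.β C ^ 2 * M.p i j ≤ η) : M.β C ^ 2 * M.avgP C ≤ η := by
  have h1 : M.β C ^ 2 * M.expEdges C ≤ C.card.choose 2 * η := by
    rw [expEdges_eq_sum, Finset.mul_sum, ← card_pairs, ← nsmul_eq_mul]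
    refine Finset.sum_le_card_nsmul _ _ _ fun e he => ?_
    have := mem_pairs.1 he
    exact hs _ this.1 _ this.2.1 this.2.2.ne
  unfold avgP
  rw [← mul_div_assoc]
  rcases Nat.eq_zero_or_pos (C.card.choose 2) with h0 | hpos
  · simpa [h0] using hη
  · rw [div_le_iff₀ (by exact_mod_cast hpos)]
    linarith

theorem expEdges_mul_h_le {ε : ℝ} {C D : Finset (Fin n)} (hDn : D.card < n) (hne : D.Nonempty)
    (hw : M.expEdges D * h (M.β C - 1) /
      ((D.card : ℝ) * Real.log ((n : ℝ) / (D.card : ℝ))) ≤ 1 - ε) :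
    M.expEdges D * h (M.β C - 1) ≤ (1 - ε) * (D.card * Real.log ((n : ℝ) / D.card)) := by
  have h1 : (0 : ℝ) < D.card := by exact_mod_cast hne.card_pos
  have h2 : (D.card : ℝ) < n := by exact_mod_cast hDn
  have h3 : 0 < Real.log ((n : ℝ) / D.card) := Real.log_pos ((one_lt_div h1).2 h2)
  rwa [div_le_iff₀ (by positivity)] at hw

theorem log_β_le {C : Finset (Fin n)} {η : ℝ} (hC : C.card = M.r) (hη0 : 0 ≤ η) (hη : η ≤ 1)
    (hs : ∀ i ∈ C, ∀ j ∈ C, i ≠ j → M.β C ^ 2 * M.p i j ≤ η) (hp : 0 < M.avgP C) :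
    2 * Real.log (M.β C) ≤ Real.log (1 / M.avgP C) := by
  have hβ := M.one_le_β C hC
  have h1 : M.β C ^ 2 ≤ 1 / M.avgP C := by
    rw [le_div_iff₀ hp]
    exact (sq_mul_avgP_le hη0 hs).trans hη
  have h2 := Real.log_le_log (by positivity) h1
  rw [Real.log_pow] at h2
  exact_mod_cast h2

/-- In a community whose average edge probability is large, a weak signal has `β_C` close to `1`. -/
theorem β_le_one_add {C : Finset (Fin n)} {ε t : ℝ} (hC : C.card = M.r) (hr : 2 ≤ M.r)
    (hrn : M.r < n) (hε : 0 ≤ ε) (ht0 : 0 < t) (ht1 : t ≤ 1) (hp : 0 < M.avgP C)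
    (hinv : 1 / M.avgP C ≤ t ^ 2 / 32 * ((M.r : ℝ) / Real.log ((n : ℝ) / (M.r : ℝ))))
    (hw : M.expEdges C * h (M.β C - 1) ≤ (1 - ε) * (M.r * Real.log ((n : ℝ) / M.r))) :
    M.β C ≤ 1 + t := by
  have hβ := M.one_le_β C hC
  have hr' : (2 : ℝ) ≤ M.r := by exact_mod_cast hr
  have hrn' : (M.r : ℝ) < n := by exact_mod_cast hrn
  set ℓ := Real.log ((n : ℝ) / M.r) with hℓ
  have hℓ0 : 0 < ℓ := Real.log_pos ((one_lt_div (by linarith)).2 hrn')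
  have hh := h_sub_one_nonneg hβ
  have h1 : ℓ ≤ t ^ 2 / 32 * (M.r * M.avgP C) := by
    rw [div_le_iff₀ hp] at hinv
    have h2 : t ^ 2 / 32 * ((M.r : ℝ) / ℓ) * M.avgP C =
        t ^ 2 / 32 * (M.r * M.avgP C) / ℓ := by ring
    rw [h2, le_div_iff₀ hℓ0] at hinv
    linarith
  rw [expEdges_eq_avgP_mul, hC] at hw
  have hX : 0 < (M.r : ℝ) * M.avgP C := by positivity
  have h2 : ((M.r : ℝ) * M.avgP C) * (M.r * h (M.β C - 1)) ≤
      ((M.r : ℝ) * M.avgP C) * (M.r * (t ^ 2 / 8)) := by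
    have h3 : (1 - ε) * (M.r * ℓ) ≤ M.r * (t ^ 2 / 32 * (M.r * M.avgP C)) := by
      have e1 : 0 ≤ ε * (M.r * ℓ) := by positivity
      have e2 := mul_le_mul_of_nonneg_left h1 (show (0 : ℝ) ≤ M.r by linarith)
      linarith
    have h4 : (M.r : ℝ) * M.avgP C * h (M.β C - 1) * (M.r - 1 - M.r / 2) ≥ 0 :=
      mul_nonneg (by positivity) (by linarith)
    nlinarith
  have h3 : h (M.β C - 1) ≤ t ^ 2 / 8 := by
    have := le_of_mul_le_mul_left h2 hX
    exact le_of_mul_le_mul_left this (by linarith)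
  -- A quadratic inequality in `β`, incompatible with `β > 1 + t`; `β ≤ 2` and `β ≥ 2` are checked
  -- separately.
  have h4 : (M.β C - 1) ^ 2 ≤ t ^ 2 / 4 * M.β C := by
    refine (sq_sub_one_le_mul_h hβ).trans ?_
    nlinarith
  by_contra hlt
  push Not at hlt
  rcases le_total (M.β C) 2 with h5 | h5
  · have : t ^ 2 < (M.β C - 1) ^ 2 := by nlinarith
    nlinarith
  · have : t ^ 2 ≤ 1 := by nlinarith
    nlinarith

/-- If `D` is sparse relative to `C`, the signal in `D` is a fraction of that in `C`. -/
theorem expEdges_mul_h_le_of_avgP_ratio_le {C D : Finset (Fin n)} {ε δ ℓ : ℝ} (hC : C.card = M.r)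
    (hr : 2 ≤ M.r) (hD : D ⊆ C) (hne : D.Nonempty) (hδ : 0 ≤ δ) (hp : 0 < M.avgP C)
    (hratio : (D.card : ℝ) * M.avgP D / ((C.card : ℝ) * M.avgP C) ≤ δ)
    (hw : M.expEdges C * h (M.β C - 1) ≤ (1 - ε) * (M.r * ℓ)) :
    M.expEdges D * h (M.β C - 1) ≤ δ * (1 - ε) * (D.card * ℓ) := by
  have hβ := M.one_le_β C hC
  have hh := h_sub_one_nonneg hβ
  have hr' : (2 : ℝ) ≤ M.r := by exact_mod_cast hr
  have hk1 : (1 : ℝ) ≤ D.card := by exact_mod_cast hne.card_pos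
  have hkr : (D.card : ℝ) ≤ M.r := by
    rw [← hC]
    exact_mod_cast Finset.card_le_card hD
  rw [hC, div_le_iff₀ (by positivity)] at hratio
  -- Edge counts carry a factor `|D| - 1` beyond the ratio `|D| p̄_D`; it is traded for `|D|` by
  -- `(|D| - 1)/(r - 1) ≤ |D|/r`.
  have h1 : M.expEdges D * (M.r - 1) ≤ δ * ((D.card - 1) * M.expEdges C) := by
    rw [expEdges_eq_avgP_mul D, expEdges_eq_avgP_mul C, hC]
    have := mul_le_mul_of_nonneg_right hratio
      (mul_nonneg (sub_nonneg.2 hk1) (show (0 : ℝ) ≤ M.r - 1 by linarith))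
    linarith
  have hμC := M.expEdges_nonneg C
  have h2 : M.expEdges D * M.r ≤ δ * (D.card * M.expEdges C) := by
    have h3 : ((D.card : ℝ) - 1) * M.r ≤ D.card * (M.r - 1) := by linarith
    have h4 : M.expEdges D * (M.r - 1) * M.r ≤ δ * (D.card * M.expEdges C) * (M.r - 1) := by
      have e1 := mul_le_mul_of_nonneg_right h1 (show (0 : ℝ) ≤ M.r by linarith)
      have e2 := mul_le_mul_of_nonneg_left h3 (mul_nonneg hδ hμC)
      linarith
    refine le_of_mul_le_mul_right ?_ (show (0 : ℝ) < M.r - 1 by linarith)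
    linarith
  have h5 := mul_le_mul_of_nonneg_right h2 hh
  have h6 := mul_le_mul_of_nonneg_left hw (mul_nonneg hδ (show (0 : ℝ) ≤ D.card by linarith))
  refine le_of_mul_le_mul_right ?_ (show (0 : ℝ) < M.r by linarith)
  linarith

end Model

/-! ### The two asymptotic regimes -/

section Asymptotics

variable {M : ∀ n, Model n} {ε : ℝ}

theorem SmallCommunity.eventually_le_risk (hcomm : SmallCommunity M)
    (hr : Tendsto (fun n => (M n).r) atTop atTop) (hsparse : Sparse M) (hε0 : 0 < ε) (hε1 : ε < 1)
    (hweak : WeakSignal M ε) {κ : ℝ} (hκ : Real.log 2 ≤ κ) :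
    ∀ᶠ n in atTop, ∀ ψ : SimpleGraph (Fin n) → Bool,
      1 - √(6 * Real.exp (-κ)) ≤ (M n).risk ψ := by
  obtain ⟨⟨a, ha, hra⟩, hlogp⟩ := hcomm
  have hξ : 0 < ε ^ 2 / 2 ^ 22 := by positivity
  have hξ1 : ε ^ 2 / 2 ^ 22 ≤ ε / 2 ^ 22 := by
    refine div_le_div_of_nonneg_right ?_ (by norm_num)
    nlinarith
  set ξ := ε ^ 2 / 2 ^ 22 with hξdef
  have hlogr : ∀ᶠ n in atTop, κ + 1 ≤ Real.log (M n).r :=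
    (Real.tendsto_log_atTop.comp (tendsto_natCast_atTop_atTop.comp hr)).eventually_ge_atTop _
  filter_upwards [hra, ha.eventually (gt_mem_nhds (show 0 < ξ / (1 + ξ) by positivity)),
    hlogp (4 * ξ) (by positivity), hsparse (ε / 32) (by positivity), hweak, hlogr,
    hr.eventually_ge_atTop 2, eventually_ge_atTop 2]
    with n hra han hlogp hs hw hlogr hr2 hn2 ψ
  have hr2' : (2 : ℝ) ≤ (M n).r := by exact_mod_cast hr2
  have hn2' : (2 : ℝ) ≤ n := by exact_mod_cast hn2
  have hlog2 : 0 < Real.log 2 := Real.log_pos (by norm_num)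
  have hlogn : 0 < Real.log n := Real.log_pos (by linarith)
  set R := Real.log (M n).r with hR
  set ℓ := Real.log ((n : ℝ) / (M n).r) with hℓ
  have hℓR : ℓ = Real.log n - R := Real.log_div (by linarith) (by linarith)
  have hRa : R = a n * Real.log n := by
    rw [hR, hra, Real.log_rpow (by linarith)]
  -- With `ℓ = log n - R`, this is equivalent to `R ≤ ξ/(1 + ξ) log n`.
  have hRξ : R ≤ ξ * ℓ := by
    have h1 : R ≤ ξ / (1 + ξ) * Real.log n := by
      rw [hRa]
      exact mul_le_mul_of_nonneg_right han.le hlogn.le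
    have h2 : (1 + ξ) * R ≤ ξ * Real.log n := by
      have := mul_le_mul_of_nonneg_left h1 (show 0 ≤ 1 + ξ by positivity)
      have e : (1 + ξ) * (ξ / (1 + ξ) * Real.log n) = ξ * Real.log n := by
        field_simp
      linarith
    rw [hℓR]
    linarith
  have hR0 : 0 < R := by linarith
  have hℓ0 : 0 < ℓ := by
    by_contra hneg
    push Not at hneg
    nlinarith
  have hrn : (M n).r < n := by
    have : (M n).r < (n : ℝ) := by
      by_contra hge
      push Not at hge
      have := Real.log_le_log (by linarith) hge
      linarith
    exact_mod_cast this
  have hlogk : ∀ k : ℕ, 0 < k → Real.log (((M n).r : ℝ) / k) ≤ R := by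
    intro k hk
    have hk' : (1 : ℝ) ≤ k := by exact_mod_cast hk
    rw [Real.log_div (by linarith) (by linarith)]
    linarith [Real.log_nonneg hk']
  -- Every size is truncated; `λ = 2 R` dominates `1 + log (r/k) + κ` because `κ + 1 ≤ R`.
  refine Model.one_sub_sqrt_exp_le_risk (T := fun _ => True) (A := fun _ => (1 - ε / 2) * ℓ)
    (lam := 2 * R) (η := ε / 32) (by omega) hrn.le (by linarith) (by positivity) hκ hs ?_ ?_ ?_ ?_ ψ
  · intro C hC D hD hne _
    have hβ := (M n).one_le_β C hC
    have hk1 : (1 : ℝ) ≤ D.card := by exact_mod_cast hne.card_pos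
    have hDr : D.card ≤ (M n).r := hC ▸ Finset.card_le_card hD
    obtain ⟨hpC, hlogpC⟩ := hlogp C hC
    refine truncated_exponent_le hε0 hε1 le_rfl hβ ((M n).expEdges_nonneg D)
      (Nat.cast_nonneg _) hℓ0.le (by positivity)
      (Model.expEdges_mul_h_le (hDr.trans_lt hrn) hne (hw C hC D hD hne)) ?_ ?_ ?_
    · rw [Real.log_div (by linarith) (by linarith)]
      have := Real.log_nonneg hk1
      have e : ε ^ 2 / 2 ^ 20 = 4 * ξ := by rw [hξdef]; ring
      rw [e]
      nlinarith
    · have e : ε ^ 2 / 2 ^ 20 = 4 * ξ := by rw [hξdef]; ring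
      rw [e]
      nlinarith
    -- `λ log β = 2 R log β ≤ R log (1/p̄_C)`, which (B)(ii) makes small compared with `ℓ`.
    · have h1 := Model.log_β_le hC (by positivity) (by linarith) (hs C hC) hpC
      have h2 : R * Real.log (1 / (M n).avgP C) ≤ R * (4 * ξ * (ℓ / R)) :=
        mul_le_mul_of_nonneg_left hlogpC hR0.le
      have h3 : R * (4 * ξ * (ℓ / R)) = 4 * ξ * ℓ := by field_simp
      have h4 := mul_le_mul_of_nonneg_left h1 hR0.le
      have e : ε ^ 2 / 2 ^ 20 = 4 * ξ := by rw [hξdef]; ring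
      rw [e]
      linarith
  · intro C _ D _ _ hT
    exact absurd trivial hT
  · intro k hk _
    have h1 := hlogk k hk
    have h2 : ξ * ℓ ≤ ε / 2 ^ 22 * ℓ := mul_le_mul_of_nonneg_right hξ1 hℓ0.le
    have h3 : 0 < ε * ℓ := by positivity
    linarith
  · intro k hk _ _
    linarith [hlogk k hk]

theorem LargeCommunity.eventually_le_risk (hcomm : LargeCommunity M)
    (hr : Tendsto (fun n => (M n).r) atTop atTop) (hsparse : Sparse M) (hε0 : 0 < ε) (hε1 : ε < 1)
    (hweak : WeakSignal M ε) {κ : ℝ} (hκ : Real.log 2 ≤ κ) :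
    ∀ᶠ n in atTop, ∀ ψ : SimpleGraph (Fin n) → Bool,
      1 - √(6 * Real.exp (-κ)) ≤ (M n).risk ψ := by
  obtain ⟨δ, hδ0, hδ1, hO, ⟨γ, hγ0, hγ, hratio⟩, hinv⟩ := hcomm
  obtain ⟨K, hK0, hK⟩ := hO.exists_pos
  have hζ : 0 < ε ^ 2 / 2 ^ 20 := by positivity
  have hζ1 : ε ^ 2 / 2 ^ 20 ≤ ε / 2 ^ 20 := by
    refine div_le_div_of_nonneg_right ?_ (by norm_num)
    nlinarith
  set ζ := ε ^ 2 / 2 ^ 20 with hζdef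
  have hlogn : Tendsto (fun n : ℕ => Real.log n) atTop atTop :=
    Real.tendsto_log_atTop.comp tendsto_natCast_atTop_atTop
  have hlog2 : 0 < Real.log 2 := Real.log_pos (by norm_num)
  filter_upwards [hK.bound, hratio, hγ.eventually (gt_mem_nhds (half_pos hζ)),
    hinv ((ε / 16) ^ 2 / 32) (by positivity), hsparse (ε / 32) (by positivity), hweak,
    hlogn.eventually_ge_atTop (2 * ((κ + 1) / (ζ / 2) + Real.log K)),
    hlogn.eventually_ge_atTop ((1 + κ + 2 * Real.log K) / (δ * ε)),
    hr.eventually_ge_atTop 2, eventually_ge_atTop 2]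
    with n hKn hratio hγn hinv hs hw hlogn₁ hlogn₂ hr2 hn2 ψ
  have hr2' : (2 : ℝ) ≤ (M n).r := by exact_mod_cast hr2
  have hn2' : (2 : ℝ) ≤ n := by exact_mod_cast hn2
  have hlogn0 : 0 < Real.log n := Real.log_pos (by linarith)
  have hγ0 := hγ0 n
  set R := Real.log (M n).r with hR
  set ℓ := Real.log ((n : ℝ) / (M n).r) with hℓ
  have hℓR : ℓ = Real.log n - R := Real.log_div (by linarith) (by linarith)
  have hR0 : 0 < R := Real.log_pos (by linarith)
  have hRK : R ≤ Real.log K + (1 / 2 - δ) * Real.log n := by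
    have hpow : 0 < (n : ℝ) ^ (1 / 2 - δ) := Real.rpow_pos_of_pos (by linarith) _
    rw [Real.norm_of_nonneg (by linarith), Real.norm_of_nonneg hpow.le] at hKn
    have := Real.log_le_log (by linarith) hKn
    rwa [Real.log_mul hK0.ne' hpow.ne', Real.log_rpow (by linarith)] at this
  -- Since `R ≤ log K + (1/2 - δ) log n`, `ℓ` is at least `log n / 2 - log K`.
  have hκℓ : κ + 1 ≤ ζ / 2 * ℓ := by
    have h1 : (κ + 1) / (ζ / 2) ≤ ℓ := by
      have := mul_pos hδ0 hlogn0
      linarith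
    rw [div_le_iff₀ (by positivity)] at h1
    linarith
  have hℓ0 : 0 < ℓ := by
    by_contra hneg
    push Not at hneg
    nlinarith
  have hrn : (M n).r < n := by
    have : (M n).r < (n : ℝ) := by
      by_contra hge
      push Not at hge
      have := Real.log_le_log (by linarith) hge
      linarith
    exact_mod_cast this
  have hnr : 0 < (n : ℝ) / (M n).r := by positivity
  have hpowγ : 0 < ((n : ℝ) / (M n).r) ^ γ n := Real.rpow_pos_of_pos hnr _
  have hlogkR : ∀ k : ℕ, 0 < k → Real.log (((M n).r : ℝ) / k) ≤ R := by
    intro k hk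
    have hk' : (1 : ℝ) ≤ k := by exact_mod_cast hk
    rw [Real.log_div (by linarith) (by linarith)]
    linarith [Real.log_nonneg hk']
  have hlogk : ∀ k : ℕ, 0 < k → ((M n).r : ℝ) / ((n : ℝ) / (M n).r) ^ γ n ≤ k →
      Real.log (((M n).r : ℝ) / k) ≤ γ n * ℓ := by
    intro k hk hT
    have hk' : (0 : ℝ) < k := by exact_mod_cast hk
    rw [div_le_iff₀ hpowγ] at hT
    have h1 : ((M n).r : ℝ) / k ≤ ((n : ℝ) / (M n).r) ^ γ n := by
      rw [div_le_iff₀ hk']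
      linarith
    have h2 := Real.log_le_log (by positivity) h1
    rwa [Real.log_rpow hnr] at h2
  have hlam : γ n * ℓ + 1 + κ ≤ ζ * ℓ := by
    have := mul_le_mul_of_nonneg_right hγn.le hℓ0.le
    linarith
  have hlam0 : 0 ≤ γ n * ℓ + 1 + κ := by
    have := mul_pos hγ0 hℓ0
    linarith
  have hwC : ∀ C : Finset (Fin n), C.card = (M n).r →
      (M n).expEdges C * h ((M n).β C - 1) ≤ (1 - ε) * ((M n).r * ℓ) := by
    intro C hC
    have hne : C.Nonempty := Finset.card_pos.1 (by omega)
    have := Model.expEdges_mul_h_le (hC ▸ hrn) hne (hw C hC C le_rfl hne)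
    rwa [hC] at this
  have hβt : ∀ C : Finset (Fin n), C.card = (M n).r → (M n).β C ≤ 1 + ε / 16 := by
    intro C hC
    exact Model.β_le_one_add hC hr2 hrn hε0.le (by positivity) (by linarith) (hinv C hC).1
      (hinv C hC).2 (hwC C hC)
  -- The threshold size is where `log (r/k) = γ ℓ`; below it the exponent has the factor `2 δ`, with
  -- 2 from `(β - 1)² ≈ 2 h(β - 1)`.
  refine Model.one_sub_sqrt_exp_le_risk
    (T := fun k => ((M n).r : ℝ) / ((n : ℝ) / (M n).r) ^ γ n ≤ k)
    (A := fun k => if ((M n).r : ℝ) / ((n : ℝ) / (M n).r) ^ γ n ≤ k then (1 - ε / 2) * ℓ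
      else 2 * δ * (1 - ε / 2) * ℓ)
    (lam := γ n * ℓ + 1 + κ) (η := ε / 32) (by omega) hrn.le (by linarith) hlam0 hκ hs
    ?_ ?_ ?_ ?_ ψ
  · intro C hC D hD hne hT
    have hβ := (M n).one_le_β C hC
    have hk0 : (0 : ℝ) < D.card := by exact_mod_cast hne.card_pos
    have hDr : D.card ≤ (M n).r := hC ▸ Finset.card_le_card hD
    simp only [if_pos hT]
    refine truncated_exponent_le hε0 hε1 le_rfl hβ ((M n).expEdges_nonneg D)
      (Nat.cast_nonneg _) hℓ0.le hlam0
      (Model.expEdges_mul_h_le (hDr.trans_lt hrn) hne (hw C hC D hD hne)) ?_ hlam ?_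
    · have h1 := hlogk D.card hne.card_pos hT
      rw [Real.log_div (by linarith) hk0.ne'] at h1 ⊢
      rw [← hζdef]
      linarith
    · have h1 : Real.log ((M n).β C) ≤ 1 := by
        have := Real.log_le_sub_one_of_pos (show 0 < (M n).β C by linarith)
        linarith [hβt C hC]
      refine le_trans ?_ hlam
      exact mul_le_of_le_one_right hlam0 h1
  · intro C hC D hD hne hT
    have hβ := (M n).one_le_β C hC
    have hμ := (M n).expEdges_nonneg D
    have hh := h_sub_one_nonneg hβ
    simp only [if_neg hT]
    have hk0 : (0 : ℝ) < D.card := by exact_mod_cast hne.card_pos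
    have h1 := Model.expEdges_mul_h_le_of_avgP_ratio_le hC hr2 hD hne hδ0.le (hinv C hC).1
      (hratio C hC D hD (not_le.1 hT)) (hwC C hC)
    have h2 : (M n).expEdges D * ((M n).β C - 1) ^ 2 ≤
        (M n).expEdges D * (2 * (1 + ε / 16) * h ((M n).β C - 1)) := by
      refine mul_le_mul_of_nonneg_left ((sq_sub_one_le_mul_h hβ).trans ?_) hμ
      exact mul_le_mul_of_nonneg_right (by linarith [hβt C hC]) hh
    have h3 : (1 + ε / 16) * ((1 + ε / 16) * (1 - ε)) ≤ 1 - ε / 2 := by nlinarith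
    have hkℓ : 0 ≤ 2 * δ * (D.card * ℓ) := by positivity
    calc (1 + 2 * (ε / 32)) * ((M n).β C - 1) ^ 2 * (M n).expEdges D
        = (1 + ε / 16) * ((M n).expEdges D * ((M n).β C - 1) ^ 2) := by ring
      _ ≤ (1 + ε / 16) * ((M n).expEdges D * (2 * (1 + ε / 16) * h ((M n).β C - 1))) :=
          mul_le_mul_of_nonneg_left h2 (by positivity)
      _ = (1 + ε / 16) * (2 * (1 + ε / 16)) * ((M n).expEdges D * h ((M n).β C - 1)) := by ring
      _ ≤ (1 + ε / 16) * (2 * (1 + ε / 16)) * (δ * (1 - ε) * (D.card * ℓ)) :=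
          mul_le_mul_of_nonneg_left h1 (by positivity)
      _ = (1 + ε / 16) * ((1 + ε / 16) * (1 - ε)) * (2 * δ * (D.card * ℓ)) := by ring
      _ ≤ (1 - ε / 2) * (2 * δ * (D.card * ℓ)) := mul_le_mul_of_nonneg_right h3 hkℓ
      _ = _ := by ring
  · intro k hk _
    split_ifs with hT
    · have h1 := hlogk k hk hT
      have h2 := mul_le_mul_of_nonneg_right hζ1 hℓ0.le
      have h3 : 0 < ε * ℓ := by positivity
      linarith
    -- Here `log (r/k)` may be as large as `R`. But `2 R ≤ (1 - 2 δ) log n + 2 log K`, and the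
    -- exponent uses at most `(2 δ - δ ε) log n`, so `δ ε log n` is left to pay for `1 + κ + 2 log
    -- K`.
    · have h1 := hlogkR k hk
      rw [div_le_iff₀ (by positivity)] at hlogn₂
      have h2 : 0 ≤ R * (2 * δ * (1 - ε / 2)) :=
        mul_nonneg hR0.le (mul_nonneg (by positivity) (by linarith))
      rw [hℓR]
      linarith
  · intro k hk _ hT
    linarith [hlogk k hk hT]

theorem eventually_one_sub_le_risk {M : ∀ n : ℕ, Model n}
    (hr : Tendsto (fun n => (M n).r) atTop atTop) (hsparse : Sparse M)
    (hcomm : LargeCommunity M ∨ SmallCommunity M) {ε : ℝ} (hε0 : 0 < ε) (hε1 : ε < 1)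
    (hweak : WeakSignal M ε) {η : ℝ} (hη : 0 < η) :
    ∀ᶠ n in atTop, ∀ ψ : SimpleGraph (Fin n) → Bool, 1 - η ≤ (M n).risk ψ := by
  -- The second term makes `6 exp (-κ) ≤ η²`; the first keeps the ratio of the geometric sums at
  -- most `1/2`.
  set κ := max (Real.log 2) (Real.log (6 / η ^ 2)) with hκ
  have hbound : √(6 * Real.exp (-κ)) ≤ η := by
    refine Real.sqrt_le_iff.2 ⟨hη.le, ?_⟩
    have h1 : 6 / η ^ 2 ≤ Real.exp κ := by
      rw [← Real.log_le_iff_le_exp (by positivity)]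
      exact le_max_right _ _
    rw [div_le_iff₀ (by positivity)] at h1
    rw [Real.exp_neg, ← div_eq_mul_inv, div_le_iff₀ (Real.exp_pos κ)]
    linarith
  have hmain : ∀ᶠ n in atTop, ∀ ψ : SimpleGraph (Fin n) → Bool,
      1 - √(6 * Real.exp (-κ)) ≤ (M n).risk ψ := by
    rcases hcomm with hA | hB
    · exact hA.eventually_le_risk hr hsparse hε0 hε1 hweak (le_max_left _ _)
    · exact hB.eventually_le_risk hr hsparse hε0 hε1 hweak (le_max_left _ _)
  filter_upwards [hmain] with n hn ψ
  linarith [hn ψ]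

end Asymptotics

end PlantedCommunity

end

theorem theorem1 (M : ∀ n : ℕ, PlantedCommunity.Model n)
    (hr : Tendsto (fun n => (M n).r) atTop atTop)
    (hsparse : PlantedCommunity.Sparse M)
    (hcomm : PlantedCommunity.LargeCommunity M ∨ PlantedCommunity.SmallCommunity M)
    (ε : ℝ) (hε0 : 0 < ε) (hε1 : ε < 1)
    (hweak : PlantedCommunity.WeakSignal M ε) :
    Tendsto (fun n => (M n).minimaxRisk) atTop (𝓝 1) ∧
      ∀ ψ : (n : ℕ) → SimpleGraph (Fin n) → Bool,
        (∀ η : ℝ, 0 < η → ∀ᶠ n in atTop, 1 - η ≤ (M n).risk (ψ n)) ∧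
        ((∀ η : ℝ, 0 < η → ∀ᶠ n in atTop, (M n).risk (ψ n) ≤ 1 + η) →
          Tendsto (fun n => (M n).risk (ψ n)) atTop (𝓝 1)) := by
  have hlow : ∀ η : ℝ, 0 < η → ∀ᶠ n in atTop, ∀ ψ : SimpleGraph (Fin n) → Bool,
      1 - η ≤ (M n).risk ψ := fun η hη =>
    PlantedCommunity.eventually_one_sub_le_risk hr hsparse hcomm hε0 hε1 hweak hη
  refine ⟨?_, fun ψ => ⟨fun η hη => ?_, fun hup => ?_⟩⟩
  · rw [Metric.tendsto_nhds]
    intro η hη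
    filter_upwards [hlow (η / 2) (half_pos hη)] with n hn
    have h1 : 1 - η / 2 ≤ (M n).minimaxRisk := le_ciInf hn
    have h2 := (M n).minimaxRisk_le_one
    rw [Real.dist_eq, abs_lt]
    constructor <;> linarith
  · filter_upwards [hlow η hη] with n hn using hn (ψ n)
  · rw [Metric.tendsto_nhds]
    intro η hη
    filter_upwards [hlow (η / 2) (half_pos hη), hup (η / 2) (half_pos hη)] with n hn hn'
    have h1 := hn (ψ n)
    rw [Real.dist_eq, abs_lt]
    constructor <;> linarith
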